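/- Let $h\ge 2$, let $\mathcal M=(m_1,\dots,m_{h-1})$ be positive integers and $\Lambda=(\lambda_1,\dots,\lambda_h)$ positive reals. **Continuous model.** Consider a tandem queue $v_0,v_1,\dots,v_h$ started with empty intermediate nodes. The source $v_0$ always has packets, the destination $v_h$ has unlimited space, and each intermediate node $v_i$ ($1\le i\le h-1$) holds at most $m_i$ packets, including the one in service. Node $v_{i-1}$ ($1\le i\le h$) is a single server whose successive service times are exponential with rate $\lambda_i$; all service times at all nodes are independent. A packet moves from $v_{i-1}$ to $v_i$ at the end of its service at $v_{i-1}$. Blocking is of type II: the server at $v_{i-1}$ is blocked while $v_i$ is full, and starts serving its next packet as soon as that packet is present, the previous one has left, and $v_i$ has space. Thus, if $D_i(k)$ is the time at which the $k$-th packet moves from $v_{i-1}$ to $v_i$ and $S_{i,k}$ is its service time at $v_{i-1}$, $$D_i(k)=\max\{D_i(k-1),\,D_{i-1}(k),\,D_{i+1}(k-m_i)\}+S_{i,k},$$ where terms with $D_0$, with $D_{h+1}$, or with packet index $\le 0$ are read as $0$. Let $N_t$ be the number of packets collected by $v_h$ in $[0,t)$. **Discrete model.** For $\mathcal E=(\varepsilon_1,\dots,\varepsilon_h)\in(0,1)^h$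 let $(\mathbf n(l))_{l\ge0}$ be the Markov chain on $\mathcal S=\prod_{i=1}^{h-1}\{0,\dots,m_i\}$ given by $n_i(l+1)=n_i(l)+Y_i(l)-Y_{i+1}(l)$. Here the $X_i(l)\in\{0,1\}$ are independent with $\Pr[X_i(l)=1]=1-\varepsilon_i$ (the packet sent from $v_{i-1}$ to $v_i$ is not erased), and $Y_i(l)=1$ if $X_i(l)=1$, ($i=1$ or $n_{i-1}(l)>0$), and ($i=h$ or $m_i-n_i(l)+Y_{i+1}(l)>0$); otherwise $Y_i(l)=0$. Put $\mathcal C^{PF}(\mathcal E,\mathcal M)=(1-\varepsilon_h)\Pr[s_{h-1}>0]$, with the probability taken in the steady-state distribution of this chain. **Theorem.** For every $\tau>0$ with $\max_i\lambda_i\tau<1$ the discrete chain with erasure probabilities $1-\Lambda\tau=(1-\lambda_1\tau,\dots,1-\lambda_h\tau)$ has exactly one stationary distribution. There is a constant $\mathcal C_\Lambda(\mathcal M)$ such that, almost surely, $N_t<\infty$ for all $t$ and $N_t/t\to\mathcal C_\Lambda(\mathcal M)$ as $t\to\infty$; and $$\mathcal C_\Lambda(\mathcal M)=\lim_{\tau\to0^+}\tau^{-1}\,\mathcal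 C^{PF}(1-\Lambda\tau,\mathcal M).$$ -/

import Mathlib

open MeasureTheory ProbabilityTheory Filter Topology Matrix

namespace LineNetwork

/-! A line network `v_0, …, v_h` with `h = r + 2 ≥ 2` hops. Links (and their transmitting nodes) are
indexed by `Fin (r + 2)`: link `i` goes from `v_i` to `v_{i+1}`. Intermediate nodes are indexed by
`Fin (r + 1)`: index `j` stands for `v_{j+1}`, which has a buffer of `m j ≥ 1` packets; link
`j.castSucc` enters it and link `j.succ` leaves it. -/

variable {r : ℕ}

/-! ### Discrete time: erasure links with perfect feedback -/

/-- Occupancies `(n_1, …, n_{h-1})` of the intermediate buffers, with `0 ≤ n_j ≤ m_j`. -/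
abbrev State (m : Fin (r + 1) → ℕ+) : Type := (j : Fin (r + 1)) → Fin ((m j : ℕ) + 1)

/-- `transfer m s x i` says whether, in an epoch that starts in state `s`, a packet is moved over
link `i` and stored at its end (`Y = 1`). Here `x i` says that link `i` does not erase in this epoch.
The transmitter must be non-empty (the source always is), the link must not erase, and the receiver
must have space after its own transmission of this epoch (the destination always has). -/
def transfer (m : Fin (r + 1) → ℕ+) (s : State m) (x : Fin (r + 2) → Bool) (i : Fin (r + 2)) :
    Bool :=
  x i &&
  (if hi : 0 < (i : ℕ) then decide (0 < (s ⟨i - 1, by omega⟩ : ℕ)) else true) &&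
  (if hi : (i : ℕ) < r + 1 then
      decide ((s ⟨i, hi⟩ : ℕ) < (m ⟨i, hi⟩ : ℕ)) || transfer m s x ⟨i + 1, by omega⟩
    else true)
termination_by r + 1 - (i : ℕ)

/-- `s'` is the state after an epoch with start state `s` and channel outcome `x`:
`n_j' = n_j + Y_j - Y_{j+1}` for every intermediate node. -/
def IsNext (m : Fin (r + 1) → ℕ+) (s : State m) (x : Fin (r + 2) → Bool) (s' : State m) : Prop :=
  ∀ j : Fin (r + 1), (s' j : ℕ) + (transfer m s x j.succ).toNat
    = (s j : ℕ) + (transfer m s x j.castSucc).toNat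

instance (m : Fin (r + 1) → ℕ+) (s : State m) (x : Fin (r + 2) → Bool) (s' : State m) :
    Decidable (IsNext m s x s') := by
  unfold IsNext; infer_instance

/-- The probability of the channel outcome `x` when link `i` erases with probability `ε i`,
independently of the other links. -/
def channelProb (ε : Fin (r + 2) → ℝ) (x : Fin (r + 2) → Bool) : ℝ :=
  ∏ i, if x i then 1 - ε i else ε i

/-- Transition matrix of the Markov chain of buffer occupancies. -/
def transitionMatrix (ε : Fin (r + 2) → ℝ) (m : Fin (r + 1) → ℕ+) :
    Matrix (State m) (State m) ℝ :=
  fun s s' => ∑ x : Fin (r + 2) → Bool with IsNext m s x s', channelProb ε x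

/-- `p` is a steady-state distribution of the occupancy chain. -/
def IsSteadyState (ε : Fin (r + 2) → ℝ) (m : Fin (r + 1) → ℕ+) (p : State m → ℝ) : Prop :=
  p ∈ stdSimplex ℝ (State m) ∧ p ᵥ* transitionMatrix ε m = p

open Classical in
/-- The steady-state distribution of the occupancy chain (it is unique when all `ε i ∈ (0, 1)`). -/
noncomputable def steadyState (ε : Fin (r + 2) → ℝ) (m : Fin (r + 1) → ℕ+) : State m → ℝ :=
  if h : ∃ p, IsSteadyState ε m p then h.choose else 0

/-- The throughput capacity with perfect feedback: `(1 - ε_h) * Pr[s_{h-1} > 0]`, the probability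
being taken in the steady state of the occupancy chain. -/
noncomputable def perfectFeedbackCapacity (ε : Fin (r + 2) → ℝ) (m : Fin (r + 1) → ℕ+) : ℝ :=
  (1 - ε (Fin.last (r + 1))) *
    ∑ s : State m with 0 < (s (Fin.last r) : ℕ), steadyState ε m s

/-! ### Continuous time: tandem queue with service times and type-II blocking -/

/-- `departureTime m S k i` is the time at which the `k`-th packet (`k = 1, 2, …`) completes service
at `v_i` and thereby moves to `v_{i+1}`; its value is `0` for `k = 0`. The service time of the
`(k+1)`-st packet at `v_i` is `S i k`. That service begins as soon as the previous packet has left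
`v_i`, the packet has arrived at `v_i` (the source has all packets at time `0`), and `v_{i+1}` has
space, i.e. the `(k+1-m)`-th packet has left `v_{i+1}`, where `m` is the buffer size of `v_{i+1}`
(no condition if `k + 1 ≤ m`, where the subtraction gives `0`, nor at the last server). -/
noncomputable def departureTime (m : Fin (r + 1) → ℕ+) (S : Fin (r + 2) → ℕ → ℝ) :
    ℕ → Fin (r + 2) → ℝ
  | 0, _ => 0
  | k + 1, i =>
    max (departureTime m S k i)
      (max (if hi : 0 < (i : ℕ) then departureTime m S (k + 1) ⟨i - 1, by omega⟩ else 0)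
        (if hi : (i : ℕ) < r + 1 then
            departureTime m S (k + 1 - (m ⟨i, hi⟩ : ℕ)) ⟨i + 1, by omega⟩
          else 0))
    + S i k
termination_by k i => (k, (i : ℕ))
decreasing_by
  · exact Prod.Lex.left _ _ (Nat.lt_succ_self k)
  · exact Prod.Lex.right _ (by omega)
  · exact Prod.Lex.left _ _ (by have := (m ⟨i, hi⟩).pos; omega)

/-- The packets collected by the destination in the period `[0, t)` (packet `k + 1` as `k`). -/
def collected (m : Fin (r + 1) → ℕ+) (S : Fin (r + 2) → ℕ → ℝ) (t : ℝ) : Set ℕ :=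
  {k | departureTime m S (k + 1) (Fin.last (r + 1)) < t}

end LineNetwork

/-! Both limits are read off one Poisson equation. Let $G$ be the generator of the continuous-time
occupancy chain, in which link $i$ attempts a transfer at rate $\lambda_i$. Every state leads to the
full state, so a maximum principle gives a function $f$ and a constant $C$ with $Gf + C$ equal to
the output rate, and $C>0$ (`exists_isPotential`).

Discrete side (`tendsto_perfectFeedbackCapacity`): with erasure probabilities $1-\lambda_i\tau$ the
transition matrix is $I+\tau G+o(\tau)$. A stationary $p$ annihilates the increment of $f$, so the
normalised capacity is $C$ plus the $p$-average of an $o(1)$ error. Convergence of $p$ itself is not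
needed.

Continuous side: no jump process is constructed. The recursion for departure times is restarted from
the numbers of services completed so far (`departureFrom`). Prolonging all services in progress by
$t$ delays every future departure by $t$, and a service in progress of length zero may be counted as
done. With memorylessness (`lintegral_pi_exp_le_sum`) this gives an exponential supermartingale
argument by induction on the remaining services (`lintegral_exp_departureFrom_le`). Packets
delivered minus potential has drift $C$ in every state, so small exponents of either sign give
Chernoff bounds on both sides of $n/C$. Borel–Cantelli yields delivery times $\sim n/C$, and
inverting gives the counting rate $C$. -/

/-! ### Finite chains: maximum principle, Poisson equation, stationary distribution. -/

namespace FiniteChain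

variable {V : Type*} [Fintype V]

/-- The generator of a chain on a finite set with jump rates `R`. -/
def generator (R : V → V → ℝ) : (V → ℝ) →ₗ[ℝ] (V → ℝ) where
  toFun f s := ∑ s', R s s' * (f s' - f s)
  map_add' f g := by
    funext s
    simp only [Pi.add_apply, ← Finset.sum_add_distrib]
    exact Finset.sum_congr rfl fun _ _ => by ring
  map_smul' c f := by
    funext s
    simp only [Pi.smul_apply, smul_eq_mul, RingHom.id_apply, Finset.mul_sum]
    exact Finset.sum_congr rfl fun _ _ => by ring

theorem generator_apply (R : V → V → ℝ) (f : V → ℝ) (s : V) :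
    generator R f s = ∑ s', R s s' * (f s' - f s) := rfl

/-- Every state leads to `o`: each nonempty set closed under possible jumps contains `o`. -/
def LeadsTo (R : V → V → ℝ) (o : V) : Prop :=
  ∀ B : Set V, B.Nonempty → (∀ s ∈ B, ∀ s', 0 < R s s' → s' ∈ B) → o ∈ B

variable {R : V → V → ℝ} {o : V}

theorem generator_nonpos_of_max (hR : ∀ s s', 0 ≤ R s s') {f : V → ℝ} {s : V}
    (hs : ∀ s', f s' ≤ f s) : generator R f s ≤ 0 :=
  Finset.sum_nonpos fun s' _ => mul_nonpos_of_nonneg_of_nonpos (hR s s') (sub_nonpos.2 (hs s'))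

/-- Maximum principle: a subharmonic function is maximal at a state to which every state leads. -/
theorem le_of_generator_nonneg (hR : ∀ s s', 0 ≤ R s s') (ho : LeadsTo R o) {f : V → ℝ}
    (hf : ∀ s, 0 ≤ generator R f s) (s : V) : f s ≤ f o := by
  have : Nonempty V := ⟨o⟩
  obtain ⟨a, ha⟩ := Finite.exists_max f
  have hmem : o ∈ {s | ∀ s', f s' ≤ f s} := by
    refine ho _ ⟨a, ha⟩ fun s hs s' hss' => ?_
    have h0 : ∑ s', R s s' * (f s - f s') = 0 := by
      have h1 := hf s
      have h2 := generator_nonpos_of_max hR hs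
      have h3 : generator R f s = 0 := le_antisymm h2 h1
      rw [generator_apply] at h3
      rw [← neg_eq_zero, ← h3, ← Finset.sum_neg_distrib]
      exact Finset.sum_congr rfl fun _ _ => by ring
    have h1 := (Finset.sum_eq_zero_iff_of_nonneg fun s' _ =>
      mul_nonneg (hR s s') (sub_nonneg.2 (hs s'))).1 h0 s' (Finset.mem_univ _)
    have h2 : f s = f s' := by
      rcases mul_eq_zero.1 h1 with h | h
      · exact absurd h hss'.ne'
      · linarith
    intro b
    rw [← h2]
    exact hs b
  exact hmem s

theorem poisson_const_nonneg (hR : ∀ s s', 0 ≤ R s s') [Nonempty V] {f g : V → ℝ} {c : ℝ}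
    (hg : ∀ s, 0 ≤ g s) (h : ∀ s, generator R f s + c = g s) : 0 ≤ c := by
  obtain ⟨a, ha⟩ := Finite.exists_max f
  have := generator_nonpos_of_max hR ha
  linarith [h a, hg a]

/-- If `c` were zero, `f` would be subharmonic, hence maximal at `o`, where its generator would be
both nonpositive and equal to `g o`. -/
theorem poisson_const_pos (hR : ∀ s s', 0 ≤ R s s') (ho : LeadsTo R o) {f g : V → ℝ} {c : ℝ}
    (hg : ∀ s, 0 ≤ g s) (hgo : 0 < g o) (h : ∀ s, generator R f s + c = g s) : 0 < c := by
  have : Nonempty V := ⟨o⟩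
  refine (poisson_const_nonneg hR hg h).lt_of_ne fun hc => ?_
  have h1 : ∀ s, generator R f s = g s := fun s => by rw [← h s, ← hc, add_zero]
  have h2 := generator_nonpos_of_max hR
    (le_of_generator_nonneg hR ho (f := f) fun s => by rw [h1]; exact hg s)
  linarith [h1 o]

/-- The generator made invertible by adding evaluation at `o`. -/
def shiftedGenerator (R : V → V → ℝ) (o : V) : (V → ℝ) →ₗ[ℝ] (V → ℝ) :=
  generator R + LinearMap.pi fun _ => LinearMap.proj o

/-- A kernel element solves a Poisson equation with zero right side and constant `f o`. Looking at
the maxima of `f` and `-f` gives `f o = 0`; then both are harmonic, so both are maximal at `o`. -/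
theorem shiftedGenerator_injective (hR : ∀ s s', 0 ≤ R s s') (ho : LeadsTo R o) :
    Function.Injective (shiftedGenerator R o) := by
  have : Nonempty V := ⟨o⟩
  rw [← LinearMap.ker_eq_bot, LinearMap.ker_eq_bot']
  intro f hf
  have h : ∀ s, generator R f s + f o = 0 := fun s => congrFun hf s
  have h1 : 0 ≤ f o := poisson_const_nonneg hR (g := 0) (fun _ => le_rfl) h
  have h2 : 0 ≤ -f o := poisson_const_nonneg hR (g := 0) (f := -f) (fun _ => le_rfl) fun s => by
    rw [map_neg, Pi.neg_apply, Pi.zero_apply]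
    linarith [h s]
  have h3 : f o = 0 := by linarith
  have h4 : ∀ s, generator R f s = 0 := fun s => by linarith [h s]
  funext s
  have h5 := le_of_generator_nonneg hR ho (f := f) (fun s => (h4 s).ge) s
  have h6 := le_of_generator_nonneg hR ho (f := -f)
    (fun s => by rw [map_neg, Pi.neg_apply, h4, neg_zero]) s
  simp only [Pi.neg_apply] at h6
  simp only [Pi.zero_apply]
  linarith

theorem shiftedGenerator_surjective (hR : ∀ s s', 0 ≤ R s s') (ho : LeadsTo R o) :
    Function.Surjective (shiftedGenerator R o) :=
  LinearMap.injective_iff_surjective.1 (shiftedGenerator_injective hR ho)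

/-- Solvability of the Poisson equation. -/
theorem exists_poisson (hR : ∀ s s', 0 ≤ R s s') (ho : LeadsTo R o) (g : V → ℝ) :
    ∃ (f : V → ℝ) (c : ℝ), ∀ s, generator R f s + c = g s := by
  obtain ⟨f, hf⟩ := shiftedGenerator_surjective hR ho g
  exact ⟨f, f o, fun s => congrFun hf s⟩

/-- For stochastic `R` the generator is `R - 1`; passing to the adjoint shows that a stationary `p`
annihilates its range. -/
theorem sum_mul_generator (hsum : ∀ s, ∑ s', R s s' = 1) (p f : V → ℝ) :
    ∑ s, p s * generator R f s = ∑ s, (vecMul p R s - p s) * f s := by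
  have h1 : ∀ s, generator R f s = ∑ s', R s s' * f s' - f s := fun s => by
    simp only [generator_apply, mul_sub, Finset.sum_sub_distrib, ← Finset.sum_mul, hsum, one_mul]
  simp only [h1, mul_sub, sub_mul, Finset.sum_sub_distrib, vecMul, dotProduct, Finset.sum_mul,
    Finset.mul_sum]
  rw [Finset.sum_comm]
  simp only [mul_assoc]

/-- A finite stochastic matrix with a state to which all states lead has exactly one stationary
distribution. -/
theorem existsUnique_stationary (hR : ∀ s s', 0 ≤ R s s') (hsum : ∀ s, ∑ s', R s s' = 1)
    (ho : LeadsTo R o) : ∃! p : V → ℝ, p ∈ stdSimplex ℝ V ∧ vecMul p R = p := by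
  classical
  have : Nonempty V := ⟨o⟩
  let L := LinearEquiv.ofBijective (shiftedGenerator R o)
    ⟨shiftedGenerator_injective hR ho, shiftedGenerator_surjective hR ho⟩
  have hL : ∀ f s, L f s = generator R f s + f o := fun f s => rfl
  -- Pairing with `p` sends `g` to the constant of its Poisson equation, which must be the
  -- stationary mean of `g`.
  let p : V → ℝ := fun s => L.symm (Pi.single s 1) o
  have hp : ∀ g : V → ℝ, ∑ s, p s * g s = L.symm g o := fun g => by
    have hg : g = ∑ s, g s • Pi.single s (1 : ℝ) := by
      funext t
      simp [Finset.sum_apply, Pi.single_apply]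
    conv_rhs => rw [hg]
    simp only [map_sum, map_smul, Finset.sum_apply, Pi.smul_apply, smul_eq_mul, p]
    exact Finset.sum_congr rfl fun _ _ => mul_comm _ _
  have hp' : ∀ f : V → ℝ, ∑ s, p s * (generator R f s + f o) = f o := fun f => by
    have := hp (L f)
    simpa only [hL, LinearEquiv.symm_apply_apply] using this
  have hp1 : ∑ s, p s = 1 := by
    simpa [generator_apply] using hp' fun _ => 1
  refine ⟨p, ⟨⟨fun s => ?_, hp1⟩, ?_⟩, ?_⟩
  · refine poisson_const_nonneg hR (f := L.symm (Pi.single s 1)) (g := Pi.single s 1)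
      (fun t => ?_) fun t => ?_
    · rw [Pi.single_apply]; split_ifs <;> norm_num
    · rw [← hL, LinearEquiv.apply_symm_apply]
  · funext t
    have h1 := hp' (Pi.single t 1)
    simp only [mul_add, Finset.sum_add_distrib, ← Finset.sum_mul, hp1, one_mul,
      sum_mul_generator hsum] at h1
    have h2 : ∑ s, (vecMul p R s - p s) * (Pi.single t (1 : ℝ) : V → ℝ) s = 0 := by linarith
    simp only [Pi.single_apply, mul_ite, mul_one, mul_zero, Finset.sum_ite_eq', Finset.mem_univ,
      if_true] at h2
    linarith
  · rintro q ⟨⟨-, hq1⟩, hq⟩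
    funext t
    -- This determines `q`, because `L` is onto.
    have h1 : ∀ f : V → ℝ, ∑ s, q s * L f s = f o := fun f => by
      simp only [hL, mul_add, Finset.sum_add_distrib, ← Finset.sum_mul, hq1, one_mul,
        sum_mul_generator hsum, hq, sub_self, zero_mul, Finset.sum_const_zero, zero_add]
    have h2 := h1 (L.symm (Pi.single t 1))
    rw [LinearEquiv.apply_symm_apply] at h2
    simpa [Pi.single_apply] using h2

end FiniteChain

/-! ### Independent exponential clocks and the first one to ring. -/

namespace ExponentialClocks

theorem lintegral_expMeasure (r : ℝ) {H : ℝ → ENNReal} (hH : Measurable H) :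
    ∫⁻ x, H x ∂expMeasure r
      = ∫⁻ x, (Set.Ici 0).indicator (fun x => ENNReal.ofReal (r * Real.exp (-(r * x))) * H x) x := by
  have h : expMeasure r = volume.withDensity (exponentialPDF r) := rfl
  have hpdf : Measurable (exponentialPDF r) := (measurable_exponentialPDFReal r).ennreal_ofReal
  rw [h, lintegral_withDensity_eq_lintegral_mul _ hpdf hH]
  refine lintegral_congr fun x => ?_
  rw [Pi.mul_apply, exponentialPDF_eq]
  by_cases hx : 0 ≤ x
  · rw [if_pos hx, Set.indicator_of_mem (Set.mem_Ici.2 hx)]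
  · rw [if_neg hx, Set.indicator_of_notMem (by simpa using hx), ENNReal.ofReal_zero, zero_mul]

theorem ae_nonneg_expMeasure (r : ℝ) : ∀ᵐ x ∂expMeasure r, 0 ≤ x := by
  rw [ae_iff, ← lintegral_indicator_one₀ (by measurability), lintegral_expMeasure]
  · rw [lintegral_eq_zero_iff']
    · refine Eventually.of_forall fun x => ?_
      by_cases hx : 0 ≤ x
      · simp [hx]
      · simp [hx]
    · exact Measurable.aemeasurable (by
        refine Measurable.indicator ?_ measurableSet_Ici
        refine Measurable.mul (by fun_prop) ?_
        exact measurable_one.indicator (by measurability))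
  · exact measurable_one.indicator (by measurability)

/-- Memorylessness of the exponential distribution. -/
theorem lintegral_indicator_Ici_expMeasure (r : ℝ) {t : ℝ} (ht : 0 ≤ t) {H : ℝ → ENNReal}
    (hH : Measurable H) :
    ∫⁻ x, (Set.Ici t).indicator H x ∂expMeasure r
      = ENNReal.ofReal (Real.exp (-(r * t))) * ∫⁻ x, H (x + t) ∂expMeasure r := by
  rw [lintegral_expMeasure r (hH.indicator measurableSet_Ici),
    lintegral_expMeasure r (H := fun x => H (x + t)) (hH.comp (measurable_add_const t)),
    ← lintegral_const_mul' _ _ ENNReal.ofReal_ne_top, ← lintegral_add_right_eq_self _ t]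
  refine lintegral_congr fun x => ?_
  by_cases hx : 0 ≤ x
  · rw [Set.indicator_of_mem (Set.mem_Ici.2 (by linarith)),
      Set.indicator_of_mem (Set.mem_Ici.2 (by linarith)), Set.indicator_of_mem (Set.mem_Ici.2 hx),
      ← mul_assoc, ← ENNReal.ofReal_mul (Real.exp_nonneg _)]
    congr 2
    rw [mul_left_comm, ← Real.exp_add]
    ring_nf
  · rw [Set.indicator_of_notMem (s := Set.Ici 0) (a := x) (by simpa using hx), mul_zero]
    rw [Set.indicator_apply]
    split_ifs
    · rw [Set.indicator_of_notMem (by simpa using hx), mul_zero]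
    · rfl

/-- The integrand is a multiple of the exponential density of rate `r + q`. Negative `q` is allowed,
as needed for the upper tail of the delivery times. -/
theorem lintegral_exp_neg_expMeasure {r q : ℝ} (hr : 0 < r) (hq : 0 < r + q) :
    ∫⁻ x, ENNReal.ofReal (Real.exp (-(q * x))) ∂expMeasure r = ENNReal.ofReal (r / (r + q)) := by
  have h1 := lintegral_expMeasure (r + q) (H := fun _ => 1) measurable_const
  have := isProbabilityMeasure_expMeasure hq
  rw [lintegral_one, measure_univ] at h1
  rw [lintegral_expMeasure r (by fun_prop), ← mul_one (ENNReal.ofReal (r / (r + q))), h1,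
    ← lintegral_const_mul' _ _ ENNReal.ofReal_ne_top]
  refine lintegral_congr fun x => ?_
  by_cases hx : x ∈ Set.Ici (0 : ℝ)
  · rw [Set.indicator_of_mem hx, Set.indicator_of_mem hx, mul_one,
      ← ENNReal.ofReal_mul (by positivity), ← ENNReal.ofReal_mul (by positivity)]
    congr 1
    rw [← mul_assoc, div_mul_cancel₀ _ hq.ne', mul_assoc, ← Real.exp_add]
    ring_nf
  · rw [Set.indicator_of_notMem hx, Set.indicator_of_notMem hx, mul_zero]

variable {ι : Type*} [DecidableEq ι]

/-- Adding `t` to the coordinates in `A`. -/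
def shift (A : Finset ι) (t : ℝ) (x : ι → ℝ) : ι → ℝ := fun j => if j ∈ A then x j + t else x j

variable [Fintype ι]

/-- A coordinate of a product of probability measures may be resampled. -/
theorem lintegral_pi_update (ν : ι → Measure ℝ) [∀ i, IsProbabilityMeasure (ν i)]
    {F : (ι → ℝ) → ENNReal} (hF : Measurable F) (i : ι) :
    ∫⁻ x, F x ∂Measure.pi ν = ∫⁻ x, ∫⁻ t, F (Function.update x i t) ∂ν i ∂Measure.pi ν := by
  have hG : (fun x => ∫⁻ t, F (Function.update x i t) ∂ν i) = ∫⋯∫⁻_{i}, F ∂ν :=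
    (lmarginal_singleton F i).symm
  have hu : (Finset.univ : Finset ι) = Finset.univ.erase i ∪ {i} := by
    ext j; by_cases h : j = i <;> simp [h]
  have hd : Disjoint (Finset.univ.erase i) ({i} : Finset ι) := by simp
  rw [hG, lintegral_eq_lmarginal_univ (0 : ι → ℝ), lintegral_eq_lmarginal_univ (0 : ι → ℝ), hu,
    lmarginal_union ν F hF hd, lmarginal_union ν _ (hF.lmarginal ν) hd]
  have hGG : ∫⋯∫⁻_{i}, (∫⋯∫⁻_{i}, F ∂ν) ∂ν = ∫⋯∫⁻_{i}, F ∂ν := by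
    rw [← hG, lmarginal_singleton]
    simp
  rw [hGG]

variable {l : ι → ℝ}

theorem lintegral_indicator_le_pi_exp (hl : ∀ i, 0 < l i) {t : ℝ} (ht : 0 ≤ t) (i : ι)
    {H : (ι → ℝ) → ENNReal} (hH : Measurable H) :
    ∫⁻ x, {x : ι → ℝ | t ≤ x i}.indicator H x ∂Measure.pi (fun i => expMeasure (l i))
      = ENNReal.ofReal (Real.exp (-(l i * t))) *
        ∫⁻ x, H (Function.update x i (x i + t)) ∂Measure.pi (fun i => expMeasure (l i)) := by
  have := fun i => isProbabilityMeasure_expMeasure (hl i)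
  have hm : Measurable fun x : ι → ℝ => H (Function.update x i (x i + t)) :=
    hH.comp (measurable_pi_lambda _ fun j => by
      rcases eq_or_ne j i with rfl | h
      · simp only [Function.update_self]; fun_prop
      · simp only [Function.update_of_ne h]; fun_prop)
  rw [lintegral_pi_update _ (hH.indicator (measurableSet_le measurable_const
      (measurable_pi_apply i))) i, lintegral_pi_update _ hm i,
    ← lintegral_const_mul' _ _ ENNReal.ofReal_ne_top]
  refine lintegral_congr fun x => ?_
  simp only [Function.update_self, Function.update_idem]
  rw [← lintegral_indicator_Ici_expMeasure (l i) ht (H := fun s => H (Function.update x i s))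
    (hH.comp (measurable_update x))]
  refine lintegral_congr fun s => ?_
  simp [Set.indicator_apply]

/-- Joint memorylessness: the clocks are treated one at a time, and the rates add in the exponent.
-/
theorem lintegral_indicator_forall_le_pi_exp (hl : ∀ i, 0 < l i) {t : ℝ} (ht : 0 ≤ t)
    (A : Finset ι) : ∀ {H : (ι → ℝ) → ENNReal}, Measurable H →
    ∫⁻ x, {x : ι → ℝ | ∀ j ∈ A, t ≤ x j}.indicator H x ∂Measure.pi (fun i => expMeasure (l i))
      = ENNReal.ofReal (Real.exp (-((∑ i ∈ A, l i) * t))) *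
        ∫⁻ x, H (shift A t x) ∂Measure.pi (fun i => expMeasure (l i)) := by
  induction A using Finset.induction_on with
  | empty =>
    intro H _
    have h : ∀ x : ι → ℝ, shift ∅ t x = x := fun x => funext fun j => by simp [shift]
    simp [h]
  | insert i A hi ih =>
    intro H hH
    have hu : Measurable fun x : ι → ℝ => Function.update x i (x i + t) :=
      measurable_pi_lambda _ fun j => by
        rcases eq_or_ne j i with rfl | h
        · simp only [Function.update_self]; fun_prop
        · simp only [Function.update_of_ne h]; fun_prop
    have hA : MeasurableSet {x : ι → ℝ | ∀ j ∈ A, t ≤ x j} := by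
      have : {x : ι → ℝ | ∀ j ∈ A, t ≤ x j} = ⋂ j ∈ A, {x | t ≤ x j} := by ext; simp
      rw [this]
      exact Finset.measurableSet_biInter A fun j _ =>
        measurableSet_le measurable_const (measurable_pi_apply j)
    have h1 : ∀ x, {x : ι → ℝ | ∀ j ∈ insert i A, t ≤ x j}.indicator H x
        = {x : ι → ℝ | t ≤ x i}.indicator ({x : ι → ℝ | ∀ j ∈ A, t ≤ x j}.indicator H) x := by
      intro x
      simp only [Set.indicator_apply, Set.mem_ofPred_eq, Finset.forall_mem_insert, ite_and]
    have h2 : ∀ x, {x : ι → ℝ | ∀ j ∈ A, t ≤ x j}.indicator H (Function.update x i (x i + t))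
        = {x : ι → ℝ | ∀ j ∈ A, t ≤ x j}.indicator
          (fun x => H (Function.update x i (x i + t))) x := by
      intro x
      simp only [Set.indicator_apply, Set.mem_ofPred_eq]
      refine if_congr (forall₂_congr fun j hj => ?_) rfl rfl
      rw [Function.update_of_ne (ne_of_mem_of_not_mem hj hi)]
    simp only [h1]
    rw [lintegral_indicator_le_pi_exp hl ht i (hH.indicator hA)]
    simp only [h2]
    rw [ih (H := fun x => H (Function.update x i (x i + t))) (hH.comp hu), ← mul_assoc, ← ENNReal.ofReal_mul (Real.exp_nonneg _), ← Real.exp_add,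
      Finset.sum_insert hi]
    congr 2
    · ring_nf
    · refine funext fun x => congrArg H (funext fun j => ?_)
      rcases eq_or_ne j i with rfl | h
      · simp [shift, hi]
      · simp [shift, h]

/-- The first of several exponential clocks to ring: if running all clocks in `A` for a time `t`
costs at most a factor `exp (-θ t)`, then the expectation of `F` is controlled by its expectations
with one of the clocks just having rung. -/
theorem lintegral_pi_exp_le_sum (hl : ∀ i, 0 < l i) {A : Finset ι} (hA : A.Nonempty) {θ : ℝ}
    (hθ : 0 < ∑ i ∈ A, l i + θ) {F : (ι → ℝ) → ENNReal} (hF : Measurable F)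
    (hshift : ∀ x, (∀ j, 0 ≤ x j) → ∀ t, 0 ≤ t →
      F (shift A t x) ≤ ENNReal.ofReal (Real.exp (-(θ * t))) * F x) :
    ∫⁻ x, F x ∂Measure.pi (fun i => expMeasure (l i)) ≤
      ∑ i ∈ A, ENNReal.ofReal (l i / (∑ j ∈ A, l j + θ)) *
        ∫⁻ x, F (Function.update x i 0) ∂Measure.pi (fun i => expMeasure (l i)) := by
  have := fun i => isProbabilityMeasure_expMeasure (hl i)
  set μ := Measure.pi (fun i => expMeasure (l i)) with hμ
  have hpos : ∀ᵐ x ∂μ, ∀ j, 0 ≤ x j :=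
    ae_all_iff.2 fun j => (Measure.quasiMeasurePreserving_eval _ j).ae (ae_nonneg_expMeasure (l j))
  have hB : ∀ i, MeasurableSet {x : ι → ℝ | ∀ j ∈ A, x i ≤ x j} := fun i => by
    have : {x : ι → ℝ | ∀ j ∈ A, x i ≤ x j} = ⋂ j ∈ A, {x | x i ≤ x j} := by ext; simp
    rw [this]
    exact Finset.measurableSet_biInter A fun j _ =>
      measurableSet_le (measurable_pi_apply i) (measurable_pi_apply j)
  -- Split by which clock is minimal. Ties are counted more than once, which is harmless for an
  -- upper bound.
  have h1 : ∫⁻ x, F x ∂μ ≤ ∑ i ∈ A, ∫⁻ x, {x : ι → ℝ | ∀ j ∈ A, x i ≤ x j}.indicator F x ∂μ := by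
    rw [← lintegral_finsetSum _ fun i _ => hF.indicator (hB i)]
    refine lintegral_mono fun x => ?_
    obtain ⟨i, hi, hmin⟩ := Finset.exists_min_image A x hA
    refine le_trans ?_ (Finset.single_le_sum (f := fun i =>
      {x : ι → ℝ | ∀ j ∈ A, x i ≤ x j}.indicator F x) (fun _ _ => zero_le) hi)
    simp only
    rw [Set.indicator_of_mem (by exact hmin)]
  refine h1.trans (Finset.sum_le_sum fun i hi => ?_)
  rw [hμ, lintegral_pi_update _ (hF.indicator (hB i)) i, ← hμ]
  have hm2 : Measurable fun p : (ι → ℝ) × ℝ => Function.update p.1 i p.2 :=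
    measurable_pi_lambda _ fun j => by
      rcases eq_or_ne j i with rfl | h
      · simp only [Function.update_self]; fun_prop
      · simp only [Function.update_of_ne h]; fun_prop
  rw [lintegral_lintegral_swap (f := fun x t =>
    {x : ι → ℝ | ∀ j ∈ A, x i ≤ x j}.indicator F (Function.update x i t)) ((hF.indicator (hB i)).comp hm2).aemeasurable]
  have hsum : ∑ j ∈ A, l j = l i + ∑ j ∈ A.erase i, l j := (Finset.add_sum_erase _ _ hi).symm
  -- Let clock `i` ring at time `s`. Survival of the other clocks in `A` costs their total rate in
  -- the exponent, after which they are fresh clocks shifted by `s`. Since `i` also sits at `0 + s`,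
  -- `hshift` applies to all of `A` and adds `θ`.
  have h2 : ∀ᵐ s ∂expMeasure (l i),
      ∫⁻ x, {x : ι → ℝ | ∀ j ∈ A, x i ≤ x j}.indicator F (Function.update x i s) ∂μ
        ≤ ENNReal.ofReal (Real.exp (-((∑ j ∈ A.erase i, l j + θ) * s))) *
          ∫⁻ x, F (Function.update x i 0) ∂μ := by
    filter_upwards [ae_nonneg_expMeasure (l i)] with s hs
    have h3 : ∀ x, {x : ι → ℝ | ∀ j ∈ A, x i ≤ x j}.indicator F (Function.update x i s)
        = {x : ι → ℝ | ∀ j ∈ A.erase i, s ≤ x j}.indicator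
          (fun x => F (Function.update x i s)) x := by
      intro x
      simp only [Set.indicator_apply, Set.mem_ofPred_eq, Function.update_self, Finset.mem_erase]
      refine if_congr ⟨fun h j hj => ?_, fun h j hj => ?_⟩ rfl rfl
      · simpa [Function.update_of_ne hj.1] using h j hj.2
      · rcases eq_or_ne j i with rfl | hji
        · simp
        · simpa [Function.update_of_ne hji] using h j ⟨hji, hj⟩
    simp only [h3]
    rw [hμ, lintegral_indicator_forall_le_pi_exp hl hs (A.erase i)
      (H := fun x => F (Function.update x i s))
      (hF.comp (hm2.comp (measurable_id.prodMk measurable_const))), ← hμ]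
    rw [add_mul, neg_add, Real.exp_add, ENNReal.ofReal_mul (Real.exp_nonneg _), mul_assoc]
    gcongr
    rw [← lintegral_const_mul' _ _ ENNReal.ofReal_ne_top]
    refine lintegral_mono_ae ?_
    filter_upwards [hpos] with x hx
    refine le_trans (le_of_eq ?_) (hshift (Function.update x i 0) (fun j => ?_) s hs)
    · refine congrArg F (funext fun j => ?_)
      rcases eq_or_ne j i with rfl | h
      · simp [shift, hi]
      · simp [shift, h]
    · rcases eq_or_ne j i with rfl | h
      · simp
      · simpa [h] using hx j
  refine (lintegral_mono_ae h2).trans ?_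
  rw [lintegral_mul_const _ (by fun_prop), lintegral_exp_neg_expMeasure (hl i)
    (by rw [← add_assoc, ← hsum]; exact hθ), ← add_assoc, ← hsum]

end ExponentialClocks

/-! ### The occupancy chain and the limit of the discrete capacity. -/

namespace LineNetwork

variable {r : ℕ}

theorem transfer_of_false (m : Fin (r + 1) → ℕ+) (s : State m) {x : Fin (r + 2) → Bool}
    {i : Fin (r + 2)} (hx : x i = false) : transfer m s x i = false := by
  rw [transfer, hx]
  simp

theorem pos_of_transfer_succ {m : Fin (r + 1) → ℕ+} {s : State m} {x : Fin (r + 2) → Bool}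
    {j : Fin (r + 1)} (h : transfer m s x j.succ = true) : 0 < (s j : ℕ) := by
  rw [transfer] at h
  simp only [Bool.and_eq_true] at h
  simpa using h.1.2

theorem lt_of_transfer_castSucc {m : Fin (r + 1) → ℕ+} {s : State m} {x : Fin (r + 2) → Bool}
    {j : Fin (r + 1)} (h : transfer m s x j.castSucc = true) :
    (s j : ℕ) < m j ∨ transfer m s x j.succ = true := by
  rw [transfer] at h
  simp only [Bool.and_eq_true] at h
  have := h.2
  simp only [Fin.val_castSucc, j.isLt, dif_pos, Bool.or_eq_true, decide_eq_true_eq] at this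
  exact this

/-- The state after an epoch. -/
def step (m : Fin (r + 1) → ℕ+) (s : State m) (x : Fin (r + 2) → Bool) : State m := fun j =>
  ⟨(s j : ℕ) + (transfer m s x j.castSucc).toNat - (transfer m s x j.succ).toNat, by
    have hs := (s j).isLt
    by_cases h1 : transfer m s x j.castSucc = true
    · rcases lt_of_transfer_castSucc h1 with h2 | h2
      · simp only [h1, Bool.toNat_true]; omega
      · simp only [h1, h2, Bool.toNat_true]; omega
    · simp only [Bool.not_eq_true] at h1
      simp only [h1, Bool.toNat_false]; omega⟩

theorem isNext_iff (m : Fin (r + 1) → ℕ+) (s : State m) (x : Fin (r + 2) → Bool) (s' : State m) :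
    IsNext m s x s' ↔ s' = step m s x := by
  have key : ∀ j, (transfer m s x j.succ).toNat ≤ (s j : ℕ) := fun j => by
    by_cases h : transfer m s x j.succ = true
    · have := pos_of_transfer_succ h
      rw [h, Bool.toNat_true]; omega
    · simp only [Bool.not_eq_true] at h
      simp [h]
  constructor
  · intro h
    funext j
    apply Fin.ext
    have := h j
    have := key j
    simp only [step]
    omega
  · rintro rfl j
    have := key j
    simp only [step]
    omega

/-- The channel outcome in which only link `i` does not erase. -/
def onlyLink (i : Fin (r + 2)) : Fin (r + 2) → Bool := fun k => decide (k = i)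

/-- The state after an attempted transmission over link `i` alone. -/
def jump (m : Fin (r + 1) → ℕ+) (s : State m) (i : Fin (r + 2)) : State m := step m s (onlyLink i)

theorem transfer_onlyLink_of_ne (m : Fin (r + 1) → ℕ+) (s : State m) {i k : Fin (r + 2)}
    (h : k ≠ i) : transfer m s (onlyLink i) k = false :=
  transfer_of_false m s (by simpa [onlyLink] using h)

/-- A packet can be moved over link `i`. -/
def CanMove (m : Fin (r + 1) → ℕ+) (s : State m) (i : Fin (r + 2)) : Prop :=
  (∀ j : Fin (r + 1), j.succ = i → 0 < (s j : ℕ)) ∧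
    ∀ j : Fin (r + 1), j.castSucc = i → (s j : ℕ) < m j

theorem transfer_onlyLink_self (m : Fin (r + 1) → ℕ+) (s : State m) (i : Fin (r + 2)) :
    transfer m s (onlyLink i) i = true ↔ CanMove m s i := by
  rw [transfer]
  have h1 : onlyLink i i = true := by simp [onlyLink]
  simp only [h1, Bool.true_and, Bool.and_eq_true, CanMove]
  refine and_congr ?_ ?_
  · refine Fin.cases ?_ (fun j => ?_) i
    · simp [Fin.succ_ne_zero]
    · simp
  · refine Fin.lastCases ?_ (fun j => ?_) i
    · simp [Fin.castSucc_ne_last]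
    · have h2 : transfer m s (onlyLink j.castSucc) j.succ = false :=
        transfer_onlyLink_of_ne m s (Fin.castSucc_lt_succ).ne'
      have h3 : ∀ h, (⟨(j.castSucc : ℕ) + 1, h⟩ : Fin (r + 2)) = j.succ := fun _ => rfl
      have h4 : (j.castSucc : ℕ) < r + 1 := j.isLt
      simp only [h3, h2, dif_pos h4, Bool.or_false, decide_eq_true_eq, Fin.castSucc_inj, forall_eq]
      rfl

theorem jump_of_not_canMove {m : Fin (r + 1) → ℕ+} {s : State m} {i : Fin (r + 2)}
    (h : ¬ CanMove m s i) : jump m s i = s := by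
  symm
  refine (isNext_iff m s _ s).1 fun j => ?_
  have : ∀ k, transfer m s (onlyLink i) k = false := fun k => by
    rcases eq_or_ne k i with rfl | hk
    · rw [← transfer_onlyLink_self] at h
      simpa using h
    · exact transfer_onlyLink_of_ne m s hk
  rw [this, this]

/-- The state with all buffers full. -/
def fullState (m : Fin (r + 1) → ℕ+) : State m := fun j => Fin.last (m j)

/-- Weight each packet by the index of the node holding it. Any transfer over a link into an
intermediate node raises the total weight by one, and such a transfer is possible unless all buffers
are full; so a maximiser in `B` is full. -/
theorem fullState_mem (m : Fin (r + 1) → ℕ+) {B : Set (State m)} (hne : B.Nonempty)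
    (hB : ∀ s ∈ B, ∀ i, jump m s i ∈ B) : fullState m ∈ B := by
  obtain ⟨s, hs, hmax⟩ := Set.exists_max_image B
    (fun s : State m => ∑ j : Fin (r + 1), ((j : ℕ) + 1) * (s j : ℕ)) B.toFinite hne
  by_contra hfull
  have hex : ∃ j : Fin (r + 1), (s j : ℕ) < m j := by
    by_contra! h
    refine hfull ?_
    have : fullState m = s := by
      funext j
      refine Fin.ext ?_
      have h1 := h j
      have h2 := (s j).isLt
      simp only [fullState, Fin.val_last]
      omega
    rwa [this]
  -- At the first non-full node, the preceding node is full, hence nonempty since buffer sizes are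
  -- positive, or is the source.
  obtain ⟨j, hj, hmin⟩ := (Set.exists_min_image {j : Fin (r + 1) | (s j : ℕ) < m j} id
    (Set.toFinite _) hex)
  simp only [Set.mem_ofPred_eq, id] at hj hmin
  have hmove : CanMove m s j.castSucc := by
    refine ⟨fun k hk => ?_, fun k hk => ?_⟩
    · by_contra h0
      have h1 := hmin k (by have := (m k).pos; omega)
      have h2 := congrArg Fin.val hk
      simp only [Fin.val_succ, Fin.val_castSucc] at h2
      rw [Fin.le_def] at h1
      omega
    · rwa [Fin.castSucc_injective _ hk]
  have hY : ∀ k, (transfer m s (onlyLink j.castSucc) k).toNat = if k = j.castSucc then 1 else 0 := by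
    intro k
    split_ifs with hk
    · rw [hk, (transfer_onlyLink_self m s _).2 hmove, Bool.toNat_true]
    · rw [transfer_onlyLink_of_ne m s hk, Bool.toNat_false]
  have hnext : IsNext m s (onlyLink j.castSucc) (jump m s j.castSucc) := (isNext_iff _ _ _ _).2 rfl
  have hle := hmax _ (hB s hs j.castSucc)
  have h1 : ∑ k : Fin (r + 1), (((k : ℕ) + 1) * (jump m s j.castSucc k : ℕ)
        + ((k : ℕ) + 1) * (if k.succ = j.castSucc then 1 else 0))
      = ∑ k : Fin (r + 1), (((k : ℕ) + 1) * (s k : ℕ)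
        + ((k : ℕ) + 1) * (if k.castSucc = j.castSucc then 1 else 0)) := by
    refine Finset.sum_congr rfl fun k _ => ?_
    rw [← mul_add, ← mul_add, ← hY, ← hY, hnext k]
  have h2 : ∑ k : Fin (r + 1), ((k : ℕ) + 1) * (if k.succ = j.castSucc then 1 else 0) = (j : ℕ) := by
    have := Fin.sum_univ_succ fun i : Fin (r + 2) => (i : ℕ) * (if i = j.castSucc then 1 else 0)
    simpa using this.symm
  simp only [Finset.sum_add_distrib, h2] at h1
  simp at h1
  omega

theorem channelProb_nonneg {ε : Fin (r + 2) → ℝ} (h0 : ∀ i, 0 ≤ ε i) (h1 : ∀ i, ε i ≤ 1)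
    (x : Fin (r + 2) → Bool) : 0 ≤ channelProb ε x :=
  Finset.prod_nonneg fun i _ => by
    split_ifs
    · linarith [h1 i]
    · exact h0 i

theorem channelProb_pos {ε : Fin (r + 2) → ℝ} (h0 : ∀ i, 0 < ε i) (h1 : ∀ i, ε i < 1)
    (x : Fin (r + 2) → Bool) : 0 < channelProb ε x :=
  Finset.prod_pos fun i _ => by
    split_ifs
    · linarith [h1 i]
    · exact h0 i

theorem sum_channelProb (ε : Fin (r + 2) → ℝ) : ∑ x, channelProb ε x = 1 := by
  have := Finset.prod_univ_sum (fun _ : Fin (r + 2) => (Finset.univ : Finset Bool))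
    (fun i b => if b then 1 - ε i else ε i)
  simp only [Fintype.piFinset_univ, Fintype.sum_bool, if_true, Bool.false_eq_true, if_false,
    sub_add_cancel, Finset.prod_const_one] at this
  exact this.symm

theorem transitionMatrix_apply (ε : Fin (r + 2) → ℝ) (m : Fin (r + 1) → ℕ+) (s s' : State m) :
    transitionMatrix ε m s s' = ∑ x, if s' = step m s x then channelProb ε x else 0 := by
  simp only [transitionMatrix, Finset.sum_filter, isNext_iff]

theorem sum_transitionMatrix_mul (ε : Fin (r + 2) → ℝ) (m : Fin (r + 1) → ℕ+) (s : State m)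
    (f : State m → ℝ) :
    ∑ s', transitionMatrix ε m s s' * f s' = ∑ x, channelProb ε x * f (step m s x) := by
  simp only [transitionMatrix_apply, Finset.sum_mul, ite_mul, zero_mul]
  rw [Finset.sum_comm]
  simp

theorem sum_transitionMatrix (ε : Fin (r + 2) → ℝ) (m : Fin (r + 1) → ℕ+) (s : State m) :
    ∑ s', transitionMatrix ε m s s' = 1 := by
  simpa [sum_channelProb] using sum_transitionMatrix_mul ε m s fun _ => 1

theorem transitionMatrix_nonneg {ε : Fin (r + 2) → ℝ} (h0 : ∀ i, 0 ≤ ε i) (h1 : ∀ i, ε i ≤ 1)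
    (m : Fin (r + 1) → ℕ+) (s s' : State m) : 0 ≤ transitionMatrix ε m s s' :=
  Finset.sum_nonneg fun x _ => channelProb_nonneg h0 h1 x

/-- Outcomes in which a single link succeeds have positive probability and already suffice. -/
theorem leadsTo_fullState {ε : Fin (r + 2) → ℝ} (h0 : ∀ i, 0 < ε i) (h1 : ∀ i, ε i < 1)
    (m : Fin (r + 1) → ℕ+) : FiniteChain.LeadsTo (transitionMatrix ε m) (fullState m) := by
  intro B hne hB
  refine fullState_mem m hne fun s hs i => hB s hs _ ?_
  rw [transitionMatrix_apply]
  refine lt_of_lt_of_le (channelProb_pos h0 h1 (onlyLink i)) ?_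
  refine le_trans (le_of_eq ?_) (Finset.single_le_sum (fun x _ => ?_) (Finset.mem_univ (onlyLink i)))
  · simp [jump]
  · split_ifs
    · exact (channelProb_pos h0 h1 x).le
    · exact le_rfl

theorem existsUnique_isSteadyState {ε : Fin (r + 2) → ℝ} (h0 : ∀ i, 0 < ε i) (h1 : ∀ i, ε i < 1)
    (m : Fin (r + 1) → ℕ+) : ∃! p, IsSteadyState ε m p :=
  FiniteChain.existsUnique_stationary
    (transitionMatrix_nonneg (fun i => (h0 i).le) (fun i => (h1 i).le) m)
    (sum_transitionMatrix ε m) (leadsTo_fullState h0 h1 m)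

theorem isSteadyState_steadyState {ε : Fin (r + 2) → ℝ} (h0 : ∀ i, 0 < ε i) (h1 : ∀ i, ε i < 1)
    (m : Fin (r + 1) → ℕ+) : IsSteadyState ε m (steadyState ε m) := by
  have h := (existsUnique_isSteadyState h0 h1 m).exists
  rw [steadyState, dif_pos h]
  exact h.choose_spec

/-- The rate at which packets reach the destination in a given state. -/
noncomputable def outputRate (Λ : Fin (r + 2) → ℝ) (m : Fin (r + 1) → ℕ+) (s : State m) : ℝ :=
  if 0 < (s (Fin.last r) : ℕ) then Λ (Fin.last (r + 1)) else 0

/-- `C` is the throughput of the continuous-time network: `f` solves the Poisson equation for the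
output rate, with constant `C`. -/
def IsPotential (Λ : Fin (r + 2) → ℝ) (m : Fin (r + 1) → ℕ+) (f : State m → ℝ) (C : ℝ) : Prop :=
  ∀ s, ∑ i, Λ i * (f (jump m s i) - f s) + C = outputRate Λ m s

theorem exists_isPotential {Λ : Fin (r + 2) → ℝ} (hΛ : ∀ i, 0 < Λ i) (m : Fin (r + 1) → ℕ+) :
    ∃ f C, IsPotential Λ m f C ∧ 0 < C := by
  -- A blocked attempt adds a rate on the diagonal, which the generator ignores.
  let R : State m → State m → ℝ := fun s s' => ∑ i, if s' = jump m s i then Λ i else 0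
  have hR : ∀ s s', 0 ≤ R s s' := fun s s' => Finset.sum_nonneg fun i _ => by
    split_ifs
    · exact (hΛ i).le
    · exact le_rfl
  have ho : FiniteChain.LeadsTo R (fullState m) := by
    intro B hne hB
    refine fullState_mem m hne fun s hs i => hB s hs _ ?_
    refine lt_of_lt_of_le (hΛ i) ?_
    refine le_trans (le_of_eq ?_) (Finset.single_le_sum (fun k _ => ?_) (Finset.mem_univ i))
    · rw [if_pos rfl]
    · split_ifs
      · exact (hΛ k).le
      · exact le_rfl
  have hgen : ∀ f s, FiniteChain.generator R f s = ∑ i, Λ i * (f (jump m s i) - f s) := by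
    intro f s
    simp only [FiniteChain.generator_apply, R, Finset.sum_mul, ite_mul, zero_mul]
    rw [Finset.sum_comm]
    simp
  obtain ⟨f, C, h⟩ := FiniteChain.exists_poisson hR ho (outputRate Λ m)
  refine ⟨f, C, fun s => by rw [← hgen, h], FiniteChain.poisson_const_pos hR ho (fun s => ?_) ?_ h⟩
  · unfold outputRate
    split_ifs
    · exact (hΛ _).le
    · exact le_rfl
  · simp [outputRate, fullState, hΛ, (m (Fin.last r)).pos]

theorem step_false (m : Fin (r + 1) → ℕ+) (s : State m) : step m s (fun _ => false) = s := by
  symm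
  refine (isNext_iff m s _ s).1 fun j => ?_
  rw [transfer_of_false m s rfl, transfer_of_false m s rfl]

theorem hasDerivAt_channelProb (Λ : Fin (r + 2) → ℝ) (x : Fin (r + 2) → Bool) :
    HasDerivAt (fun τ : ℝ => channelProb (fun i => 1 - Λ i * τ) x)
      (∑ i, (∏ j ∈ Finset.univ.erase i, if x j then 0 else 1) * if x i then Λ i else -Λ i) 0 := by
  have h : ∀ i ∈ (Finset.univ : Finset (Fin (r + 2))), HasDerivAt
      (fun τ : ℝ => if x i then 1 - (1 - Λ i * τ) else 1 - Λ i * τ)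
      (if x i then Λ i else -Λ i) 0 := by
    intro i _
    have h1 : HasDerivAt (fun τ : ℝ => Λ i * τ) (Λ i) 0 := by
      simpa using (hasDerivAt_id (0 : ℝ)).const_mul (Λ i)
    split_ifs
    · simpa using h1
    · simpa using h1.const_sub 1
  have := HasDerivAt.fun_finsetProd h
  simpa [channelProb, smul_eq_mul] using this

/-- Two or more successes have probability of order `τ ^ 2`, so only single successes survive in the
derivative; the all-erased outcome is removed by `hu`. -/
theorem sum_deriv_channelProb (Λ : Fin (r + 2) → ℝ) (u : (Fin (r + 2) → Bool) → ℝ)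
    (hu : u (fun _ => false) = 0) :
    ∑ x, (∑ i, (∏ j ∈ Finset.univ.erase i, if x j then (0 : ℝ) else 1) *
      if x i then Λ i else -Λ i) * u x = ∑ i, Λ i * u (onlyLink i) := by
  simp only [Finset.sum_mul]
  rw [Finset.sum_comm]
  refine Finset.sum_congr rfl fun i _ => ?_
  rw [Finset.sum_eq_single_of_mem (onlyLink i) (Finset.mem_univ _)]
  · rw [Finset.prod_eq_one fun j hj => by simp [onlyLink, Finset.ne_of_mem_erase hj]]
    simp [onlyLink]
  · intro x _ hx
    by_cases h : ∃ j ∈ Finset.univ.erase i, x j = true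
    · obtain ⟨j, hj, hxj⟩ := h
      rw [Finset.prod_eq_zero hj (by simp [hxj]), zero_mul, zero_mul]
    · push Not at h
      have : x = fun _ => false := by
        funext k
        rcases eq_or_ne k i with rfl | hk
        · by_contra hxk
          refine hx (funext fun j => ?_)
          rcases eq_or_ne j k with rfl | hj
          · simpa [onlyLink] using hxk
          · simpa [onlyLink, hj] using h j (by simp [hj])
        · simpa using h k (by simp [hk])
      rw [this, hu, mul_zero]

theorem tendsto_perfectFeedbackCapacity {Λ : Fin (r + 2) → ℝ} (hΛ : ∀ i, 0 < Λ i)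
    {m : Fin (r + 1) → ℕ+} {f : State m → ℝ} {C : ℝ} (hf : IsPotential Λ m f C) :
    Tendsto (fun τ : ℝ => τ⁻¹ * perfectFeedbackCapacity (fun i => 1 - Λ i * τ) m)
      (𝓝[>] 0) (𝓝 C) := by
  let P : ℝ → State m → ℝ := fun τ s =>
    ∑ x, channelProb (fun i => 1 - Λ i * τ) x * (f (step m s x) - f s)
  let Q : State m → ℝ := fun s => ∑ i, Λ i * (f (jump m s i) - f s)
  have hP : ∀ s, Tendsto (fun τ => τ⁻¹ * P τ s) (𝓝[>] 0) (𝓝 (Q s)) := by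
    intro s
    have h1 : HasDerivAt (fun τ => P τ s) (Q s) 0 := by
      have := HasDerivAt.fun_sum (u := Finset.univ) fun x _ =>
        (hasDerivAt_channelProb Λ x).mul_const (f (step m s x) - f s)
      rwa [sum_deriv_channelProb Λ (fun x => f (step m s x) - f s)
        (by rw [step_false, sub_self])] at this
    have h2 := h1.tendsto_slope.mono_left (nhdsWithin_mono 0 fun x (hx : 0 < x) => hx.ne')
    refine h2.congr fun τ => ?_
    have h3 : P 0 s = 0 := by
      refine Finset.sum_eq_zero fun x _ => ?_
      by_cases h : ∃ j, x j = true
      · obtain ⟨j, hj⟩ := h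
        rw [channelProb, Finset.prod_eq_zero (Finset.mem_univ j) (by simp [hj]), zero_mul]
      · push Not at h
        have : x = fun _ => false := funext fun k => by simpa using h k
        rw [this, step_false, sub_self, mul_zero]
    simp [slope_def_field, h3, div_eq_inv_mul]
  have hsmall : ∀ᶠ τ : ℝ in 𝓝[>] 0, ∀ i, Λ i * τ < 1 := by
    refine eventually_all.2 fun i => ?_
    have : Tendsto (fun τ : ℝ => Λ i * τ) (𝓝[>] 0) (𝓝 (Λ i * 0)) :=
      ((continuous_const.mul continuous_id).tendsto 0).mono_left nhdsWithin_le_nhds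
    rw [mul_zero] at this
    exact this.eventually (gt_mem_nhds one_pos)
  have hbound : Tendsto (fun τ => ∑ s, |Q s - τ⁻¹ * P τ s|) (𝓝[>] 0) (𝓝 0) := by
    have := tendsto_finsetSum (Finset.univ : Finset (State m)) fun s _ =>
      (tendsto_const_nhds (x := Q s)).sub (hP s) |>.abs
    simpa using this
  rw [tendsto_iff_dist_tendsto_zero]
  refine squeeze_zero' (Eventually.of_forall fun _ => dist_nonneg) ?_ hbound
  filter_upwards [hsmall, self_mem_nhdsWithin] with τ hτ hτ0
  have hτ0 : 0 < τ := hτ0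
  obtain ⟨⟨hp0, hp1⟩, hp⟩ := isSteadyState_steadyState (ε := fun i => 1 - Λ i * τ)
    (fun i => by linarith [hτ i]) (fun i => by have := mul_pos (hΛ i) hτ0; linarith) m
  set p := steadyState (fun i => 1 - Λ i * τ) m
  have hgen : ∀ s, FiniteChain.generator (transitionMatrix (fun i => 1 - Λ i * τ) m) f s = P τ s := by
    intro s
    change ∑ s', transitionMatrix (fun i => 1 - Λ i * τ) m s s' * (f s' - f s) = _
    simp only [P, mul_sub, Finset.sum_sub_distrib,
      sum_transitionMatrix_mul, ← Finset.sum_mul, sum_transitionMatrix, sum_channelProb]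
  have h1 : ∑ s, p s * P τ s = 0 := by
    have := FiniteChain.sum_mul_generator
      (sum_transitionMatrix (fun i => 1 - Λ i * τ) m) p f
    simpa only [hgen, hp, sub_self, zero_mul, Finset.sum_const_zero] using this
  have h2 : τ⁻¹ * perfectFeedbackCapacity (fun i => 1 - Λ i * τ) m
      = ∑ s, p s * outputRate Λ m s := by
    simp only [perfectFeedbackCapacity, outputRate, Finset.sum_filter, mul_ite, mul_zero,
      Finset.mul_sum]
    refine Finset.sum_congr rfl fun s _ => ?_
    split_ifs
    · rw [sub_sub_cancel]
      change τ⁻¹ * (Λ (Fin.last (r + 1)) * τ * p s) = p s * Λ (Fin.last (r + 1))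
      rw [mul_right_comm, mul_comm τ⁻¹, mul_assoc, mul_inv_cancel₀ hτ0.ne', mul_one, mul_comm]
    · rfl
  -- Stationarity removes the `P` term on the right, leaving the Poisson equation averaged over `p`.
  -- Only `p s ≤ 1` is used afterwards, so the dependence of `p` on `τ` does not matter.
  have h3 : ∑ s, p s * outputRate Λ m s - C = ∑ s, p s * (Q s - τ⁻¹ * P τ s) := by
    have h4 : ∑ s, p s * (τ⁻¹ * P τ s) = τ⁻¹ * ∑ s, p s * P τ s := by
      rw [Finset.mul_sum]
      exact Finset.sum_congr rfl fun _ _ => by ring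
    have h5 : ∀ s, outputRate Λ m s = Q s + C := fun s => (hf s).symm
    simp only [mul_sub, Finset.sum_sub_distrib, h4, h1, h5, mul_add, Finset.sum_add_distrib,
      ← Finset.sum_mul, hp1]
    ring
  rw [h2, Real.dist_eq, h3]
  refine (Finset.abs_sum_le_sum_abs _ _).trans (Finset.sum_le_sum fun s _ => ?_)
  rw [abs_mul, abs_of_nonneg (hp0 s)]
  refine mul_le_of_le_one_left (abs_nonneg _) ?_
  rw [← hp1]
  exact Finset.single_le_sum (fun t _ => hp0 t) (Finset.mem_univ s)

end LineNetwork

/-! ### Departure times restarted from given completion counts. -/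

namespace LineNetwork

variable {r : ℕ}

/-- Departure times counted from a moment at which server `i` has already completed its first
`a i` services; these services have departure time `0`. -/
noncomputable def departureFrom (m : Fin (r + 1) → ℕ+) (a : Fin (r + 2) → ℕ)
    (S : Fin (r + 2) → ℕ → ℝ) : ℕ → Fin (r + 2) → ℝ
  | 0, _ => 0
  | k + 1, i =>
    if k + 1 ≤ a i then 0 else
    max (departureFrom m a S k i)
      (max (if hi : 0 < (i : ℕ) then departureFrom m a S (k + 1) ⟨i - 1, by omega⟩ else 0)
        (if hi : (i : ℕ) < r + 1 then
            departureFrom m a S (k + 1 - (m ⟨i, hi⟩ : ℕ)) ⟨i + 1, by omega⟩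
          else 0))
    + S i k
termination_by k i => (k, (i : ℕ))
decreasing_by
  · exact Prod.Lex.left _ _ (Nat.lt_succ_self k)
  · exact Prod.Lex.right _ (by omega)
  · exact Prod.Lex.left _ _ (by have := (m ⟨i, hi⟩).pos; omega)

/-- Induction along the recursion for departure times. -/
theorem packet_induction {p : ℕ → Fin (r + 2) → Prop} (zero : ∀ i, p 0 i)
    (succ : ∀ k i, (∀ k' ≤ k, ∀ i', p k' i') → (∀ i' < i, p (k + 1) i') → p (k + 1) i) :
    ∀ k i, p k i := by
  intro k
  induction k using Nat.strong_induction_on with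
  | _ k ih =>
    intro i
    induction i using WellFoundedLT.induction with
    | _ i ihi =>
      cases k with
      | zero => exact zero i
      | succ k => exact succ k i (fun k' hk' => ih k' (by omega)) ihi

variable {m : Fin (r + 1) → ℕ+} {a : Fin (r + 2) → ℕ} {S S' : Fin (r + 2) → ℕ → ℝ}

theorem departureFrom_of_le {k : ℕ} {i : Fin (r + 2)} (h : k ≤ a i) :
    departureFrom m a S k i = 0 := by
  cases k with
  | zero => rw [departureFrom]
  | succ k => rw [departureFrom, if_pos h]

theorem departureFrom_zero_eq (m : Fin (r + 1) → ℕ+) (S : Fin (r + 2) → ℕ → ℝ) :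
    ∀ k i, departureFrom m 0 S k i = departureTime m S k i := by
  refine packet_induction (fun i => ?_) fun k i h1 h2 => ?_
  · rw [departureFrom, departureTime]
  · rw [departureFrom, departureTime, if_neg (by simp), h1 k le_rfl]
    congr 3
    · exact dite_congr rfl (fun hi => h2 _ (by rw [Fin.lt_def]; simp only; omega)) fun _ => rfl
    · exact dite_congr rfl
        (fun hi => h1 _ (by have := (m ⟨i, hi⟩).pos; omega) _) fun _ => rfl

theorem departureFrom_congr {n : ℕ} (h : ∀ i k, a i ≤ k → k < n → S i k = S' i k) :
    ∀ k i, k ≤ n → departureFrom m a S k i = departureFrom m a S' k i := by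
  refine packet_induction (fun i _ => ?_) fun k i h1 h2 hk => ?_
  · rw [departureFrom, departureFrom]
  · rw [departureFrom, departureFrom]
    by_cases ha : k + 1 ≤ a i
    · rw [if_pos ha, if_pos ha]
    · rw [if_neg ha, if_neg ha, h1 k le_rfl _ (by omega), h i k (by omega) (by omega)]
      congr 3
      · exact dite_congr rfl
          (fun hi => h2 _ (by rw [Fin.lt_def]; simp only; omega) hk) fun _ => rfl
      · exact dite_congr rfl
          (fun hi => h1 _ (by have := (m ⟨i, hi⟩).pos; omega) _ (by omega)) fun _ => rfl

theorem departureFrom_nonneg (hS : ∀ i k, 0 ≤ S i k) : ∀ k i, 0 ≤ departureFrom m a S k i := by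
  refine packet_induction (fun i => ?_) fun k i h1 _ => ?_
  · rw [departureFrom]
  · rw [departureFrom]
    split_ifs
    · exact le_rfl
    all_goals exact add_nonneg (le_max_of_le_left (h1 k le_rfl i)) (hS i k)

/-- Server `i` is in service when the servers have completed `a` services. -/
def Ready (m : Fin (r + 1) → ℕ+) (a : Fin (r + 2) → ℕ) (i : Fin (r + 2)) : Prop :=
  (∀ _ : 0 < (i : ℕ), a i + 1 ≤ a ⟨i - 1, by omega⟩) ∧
    ∀ hi : (i : ℕ) < r + 1, a i + 1 - (m ⟨i, hi⟩ : ℕ) ≤ a ⟨i + 1, by omega⟩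

/-- Terms stuck at zero do not spoil the shift: one term is delayed, so the new maximum is at least
`t`. -/
theorem max_eq_max_add {u v w u' v' w' t : ℝ} (ht : 0 ≤ t) (hu : 0 ≤ u) (hv : 0 ≤ v) (hw : 0 ≤ w)
    (h1 : u' = u + t ∨ u = 0 ∧ u' = 0) (h2 : v' = v + t ∨ v = 0 ∧ v' = 0)
    (h3 : w' = w + t ∨ w = 0 ∧ w' = 0) (h : u' = u + t ∨ v' = v + t ∨ w' = w + t) :
    max u' (max v' w') = max u (max v w) + t := by
  have hle : ∀ {x x' : ℝ}, (x' = x + t ∨ x = 0 ∧ x' = 0) → x' ≤ x + t := by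
    rintro x x' (h | ⟨h, h'⟩) <;> linarith
  refine le_antisymm (max_le ?_ (max_le ?_ ?_)) ?_
  · exact (hle h1).trans (by gcongr; exact le_max_left _ _)
  · exact (hle h2).trans (by gcongr; exact (le_max_left _ _).trans (le_max_right _ _))
  · exact (hle h3).trans (by gcongr; exact (le_max_right _ _).trans (le_max_right _ _))
  · have hu' : u' ≤ max u' (max v' w') := le_max_left _ _
    have hv' : v' ≤ max u' (max v' w') := (le_max_left _ _).trans (le_max_right _ _)
    have hw' : w' ≤ max u' (max v' w') := (le_max_right _ _).trans (le_max_right _ _)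
    have ht' : t ≤ max u' (max v' w') := by rcases h with h | h | h <;> linarith
    rw [← max_add_add_right, ← max_add_add_right]
    refine max_le ?_ (max_le ?_ ?_)
    · rcases h1 with h | h <;> linarith
    · rcases h2 with h | h <;> linarith
    · rcases h3 with h | h <;> linarith

open Classical in
/-- If all current services take `t` longer, then all future departures are delayed by `t`. -/
theorem departureFrom_add {t : ℝ} (ht : 0 ≤ t) (hS : ∀ i k, 0 ≤ S i k)
    (hS' : ∀ i k, S' i k = S i k + if Ready m a i ∧ k = a i then t else 0) :
    ∀ k i, a i < k → departureFrom m a S' k i = departureFrom m a S k i + t := by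
  refine packet_induction (fun i hi => by omega) fun k i h1 h2 hk => ?_
  have key : ∀ k' i', (a i' < k' → departureFrom m a S' k' i' = departureFrom m a S k' i' + t) →
      (departureFrom m a S' k' i' = departureFrom m a S k' i' + t ∨
        departureFrom m a S k' i' = 0 ∧ departureFrom m a S' k' i' = 0) := by
    intro k' i' h
    rcases lt_or_ge (a i') k' with h' | h'
    · exact Or.inl (h h')
    · exact Or.inr ⟨departureFrom_of_le h', departureFrom_of_le h'⟩
  have hprev : ∀ hi : 0 < (i : ℕ), (⟨i - 1, by omega⟩ : Fin (r + 2)) < i := fun hi => by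
    rw [Fin.lt_def]; simp only; omega
  have hle : ∀ hi : (i : ℕ) < r + 1, k + 1 - (m ⟨i, hi⟩ : ℕ) ≤ k := fun hi => by
    have := (m ⟨i, hi⟩).pos; omega
  rw [departureFrom, departureFrom, if_neg (by omega), if_neg (by omega), hS']
  by_cases hready : Ready m a i ∧ k = a i
  -- For a service in progress all three terms of the maximum are completed, hence zero, and the
  -- delay comes from the service time itself.
  · obtain ⟨hr, rfl⟩ := hready
    rw [if_pos ⟨hr, rfl⟩, ← add_assoc, departureFrom_of_le le_rfl, departureFrom_of_le le_rfl]
    congr 4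
    · refine dite_congr rfl (fun hi => ?_) fun _ => rfl
      rw [departureFrom_of_le (hr.1 hi), departureFrom_of_le (hr.1 hi)]
    · refine dite_congr rfl (fun hi => ?_) fun _ => rfl
      rw [departureFrom_of_le (hr.2 hi), departureFrom_of_le (hr.2 hi)]
  · rw [if_neg hready, add_zero, add_right_comm]
    congr 1
    have hnn := departureFrom_nonneg (m := m) (a := a) hS
    refine max_eq_max_add ht (hnn _ _) ?_ ?_ (key _ _ (h1 k le_rfl i)) ?_ ?_ ?_
    · split_ifs
      · exact hnn _ _
      · exact le_rfl
    · split_ifs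
      · exact hnn _ _
      · exact le_rfl
    · split_ifs with hi
      · exact key _ _ (h2 _ (hprev hi))
      · exact Or.inr ⟨rfl, rfl⟩
    · split_ifs with hi
      · exact key _ _ (h1 _ (hle hi) _)
      · exact Or.inr ⟨rfl, rfl⟩
    -- The delay is inherited: from the previous service at `i` if that is unfinished, otherwise
    -- from the missing packet or the missing space that keeps `i` from being ready.
    · rcases lt_or_ge (a i) k with hk' | hk'
      · exact Or.inl (h1 k le_rfl i hk')
      · have hka : k = a i := by omega
        have hnr : ¬ Ready m a i := fun h => hready ⟨h, hka⟩
        rw [Ready, not_and_or, not_forall, not_forall] at hnr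
        right
        rcases hnr with ⟨hi, h⟩ | ⟨hi, h⟩
        · left
          rw [dif_pos hi, dif_pos hi]
          exact h2 _ (hprev hi) (by omega)
        · right
          rw [dif_pos hi, dif_pos hi]
          exact h1 _ (hle hi) _ (by omega)

/-- A current service of length `0` may be counted as completed. -/
theorem departureFrom_update {i : Fin (r + 2)} (hi : Ready m a i) (hS : S i (a i) = 0) :
    ∀ k j, departureFrom m a S k j = departureFrom m (Function.update a i (a i + 1)) S k j := by
  refine packet_induction (fun j => ?_) fun k j h1 h2 => ?_
  · rw [departureFrom, departureFrom]
  · by_cases hj : j = i ∧ k = a i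
    · obtain ⟨rfl, rfl⟩ := hj
      rw [departureFrom_of_le (k := a j + 1) (a := Function.update a j (a j + 1)) (by simp),
        departureFrom, if_neg (by omega), hS, departureFrom_of_le le_rfl]
      have e1 : (if h : 0 < (j : ℕ) then
          departureFrom m a S (a j + 1) ⟨j - 1, by omega⟩ else 0) = 0 := by
        split_ifs with h
        · exact departureFrom_of_le (hi.1 h)
        · rfl
      have e2 : (if h : (j : ℕ) < r + 1 then
          departureFrom m a S (a j + 1 - (m ⟨j, h⟩ : ℕ)) ⟨j + 1, by omega⟩ else 0) = 0 := by
        split_ifs with h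
        · exact departureFrom_of_le (hi.2 h)
        · rfl
      rw [e1, e2]
      simp
    · have hc : k + 1 ≤ a j ↔ k + 1 ≤ Function.update a i (a i + 1) j := by
        rcases eq_or_ne j i with rfl | h
        · simp only [Function.update_self]; omega
        · rw [Function.update_of_ne h]
      rw [departureFrom, departureFrom]
      refine ite_congr (propext hc) (fun _ => rfl) fun _ => ?_
      rw [h1 k le_rfl]
      congr 3
      · exact dite_congr rfl
          (fun hi => h2 _ (by rw [Fin.lt_def]; simp only; omega)) fun _ => rfl
      · exact dite_congr rfl
          (fun hi => h1 _ (by have := (m ⟨j, hi⟩).pos; omega) _) fun _ => rfl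

/-- The completion counts `a` respect precedence and buffer sizes. -/
def Valid (m : Fin (r + 1) → ℕ+) (a : Fin (r + 2) → ℕ) : Prop :=
  ∀ j : Fin (r + 1), a j.succ ≤ a j.castSucc ∧ a j.castSucc ≤ a j.succ + m j

/-- The occupancies that correspond to completion counts. -/
def occupancy (m : Fin (r + 1) → ℕ+) (a : Fin (r + 2) → ℕ) : State m := fun j =>
  ⟨min (a j.castSucc - a j.succ) (m j), by omega⟩

theorem Valid.coe_occupancy (ha : Valid m a) (j : Fin (r + 1)) :
    (occupancy m a j : ℕ) = a j.castSucc - a j.succ := by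
  have := ha j
  simp only [occupancy]
  omega

theorem Valid.ready_iff (ha : Valid m a) (i : Fin (r + 2)) :
    Ready m a i ↔ CanMove m (occupancy m a) i := by
  unfold Ready CanMove
  refine and_congr ?_ ?_
  · refine Fin.cases ?_ (fun j => ?_) i
    · simp [Fin.succ_ne_zero]
    · have e : ∀ h, (⟨(j.succ : ℕ) - 1, h⟩ : Fin (r + 2)) = j.castSucc := fun _ => rfl
      simp only [e, Fin.succ_inj, forall_eq, ha.coe_occupancy]
      simp
  · refine Fin.lastCases ?_ (fun j => ?_) i
    · simp [Fin.castSucc_ne_last]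
    · have e : ∀ h, (⟨(j.castSucc : ℕ) + 1, h⟩ : Fin (r + 2)) = j.succ := fun _ => rfl
      have e' : ∀ h, (⟨(j.castSucc : ℕ), h⟩ : Fin (r + 1)) = j := fun _ => rfl
      have hj : (j.castSucc : ℕ) < r + 1 := j.isLt
      have := ha j
      have := (m j).pos
      simp only [e, e', Fin.castSucc_inj, forall_eq, ha.coe_occupancy, hj, forall_true_left]
      omega

theorem Valid.update (ha : Valid m a) {i : Fin (r + 2)} (hi : Ready m a i) :
    Valid m (Function.update a i (a i + 1)) := by
  have hmove := (ha.ready_iff i).1 hi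
  intro j
  have := ha j
  have h0 : j.castSucc ≠ j.succ := (Fin.castSucc_lt_succ).ne
  rcases eq_or_ne j.succ i with h1 | h1
  · have := hmove.1 j h1
    rw [ha.coe_occupancy] at this
    subst h1
    rw [Function.update_self, Function.update_of_ne h0]
    omega
  · rw [Function.update_of_ne h1]
    rcases eq_or_ne j.castSucc i with h2 | h2
    · have := hmove.2 j h2
      rw [ha.coe_occupancy] at this
      subst h2
      rw [Function.update_self]
      omega
    · rw [Function.update_of_ne h2]
      exact ha j

/-- With `Valid.ready_iff`, this identifies service completions in the recursion with the jumps in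
the Poisson equation. -/
theorem Valid.occupancy_update (ha : Valid m a) {i : Fin (r + 2)} (hi : Ready m a i) :
    occupancy m (Function.update a i (a i + 1)) = jump m (occupancy m a) i := by
  refine (isNext_iff m _ _ _).1 fun j => ?_
  have hmove := (ha.ready_iff i).1 hi
  have hY : ∀ k, (transfer m (occupancy m a) (onlyLink i) k).toNat = if k = i then 1 else 0 := by
    intro k
    split_ifs with hk
    · rw [hk, (transfer_onlyLink_self m _ _).2 hmove, Bool.toNat_true]
    · rw [transfer_onlyLink_of_ne m _ hk, Bool.toNat_false]
  have hv := ha.update hi j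
  rw [hY, hY, (ha.update hi).coe_occupancy, ha.coe_occupancy]
  have := ha j
  have h0 : j.castSucc ≠ j.succ := (Fin.castSucc_lt_succ).ne
  rcases eq_or_ne j.succ i with h1 | h1
  · subst h1
    rw [if_pos rfl, if_neg h0]
    rw [Function.update_self, Function.update_of_ne h0] at hv ⊢
    omega
  · rw [if_neg h1]
    rw [Function.update_of_ne h1] at hv ⊢
    rcases eq_or_ne j.castSucc i with h2 | h2
    · subst h2
      rw [Function.update_self] at hv ⊢
      rw [if_pos rfl]
      omega
    · rw [Function.update_of_ne h2, if_neg h2]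

/-- Each buffer bounds the lead of the server feeding it. Hence finitely many service times suffice
up to the `n`-th delivery, and finite product measures can be used. -/
theorem Valid.le_last (ha : Valid m a) (i : Fin (r + 2)) :
    a i ≤ a (Fin.last (r + 1)) + (r + 1 - i) * ∑ j, (m j : ℕ) := by
  induction i using Fin.reverseInduction with
  | last => simp
  | cast j ih =>
    have h1 := (ha j).2
    have h2 : (m j : ℕ) ≤ ∑ j, (m j : ℕ) :=
      Finset.single_le_sum (f := fun j => (m j : ℕ)) (fun _ _ => Nat.zero_le _) (Finset.mem_univ j)
    have h3 : r + 1 - (j.castSucc : ℕ) = (r + 1 - (j.succ : ℕ)) + 1 := by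
      have := j.isLt
      simp only [Fin.val_castSucc, Fin.val_succ]
      omega
    rw [h3, Nat.succ_mul]
    omega

end LineNetwork

/-! ### Exponential moments of the delivery times. -/

namespace LineNetwork

variable {r : ℕ} {m : Fin (r + 1) → ℕ+} {Λ : Fin (r + 2) → ℝ}

open Classical in
/-- The increment of (packets delivered minus potential) when server `i` completes a service. -/
noncomputable def gain (m : Fin (r + 1) → ℕ+) (f : State m → ℝ) (s : State m) (i : Fin (r + 2)) :
    ℝ :=
  (if i = Fin.last (r + 1) ∧ CanMove m s i then 1 else 0) - (f (jump m s i) - f s)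

theorem canMove_last (m : Fin (r + 1) → ℕ+) (s : State m) :
    CanMove m s (Fin.last (r + 1)) ↔ 0 < (s (Fin.last r) : ℕ) := by
  constructor
  · exact fun h => h.1 _ (Fin.succ_last r)
  · refine fun h => ⟨fun j hj => ?_, fun j hj => absurd hj (Fin.castSucc_ne_last j)⟩
    rw [← Fin.succ_last r] at hj
    rwa [Fin.succ_injective _ hj]

theorem gain_of_not_canMove {f : State m → ℝ} {s : State m} {i : Fin (r + 2)}
    (h : ¬ CanMove m s i) : gain m f s i = 0 := by
  simp [gain, h, jump_of_not_canMove h]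

open Classical in
-- The Poisson equation rewritten as a drift that is the same in every state.
theorem IsPotential.sum_gain {f : State m → ℝ} {C : ℝ} (hf : IsPotential Λ m f C) (s : State m) :
    ∑ i, Λ i * gain m f s i = C := by
  have h := hf s
  have h1 : ∑ i, Λ i * (if i = Fin.last (r + 1) ∧ CanMove m s i then (1 : ℝ) else 0)
      = outputRate Λ m s := by
    rw [Finset.sum_eq_single_of_mem (Fin.last (r + 1)) (Finset.mem_univ _)
      fun i _ hi => by simp [hi]]
    simp [outputRate, canMove_last]
  simp only [gain, mul_sub, Finset.sum_sub_distrib] at h ⊢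
  linarith

/-- No deadlock: if every link were blocked, all gains and hence the drift `C` would vanish. -/
theorem IsPotential.exists_canMove {f : State m → ℝ} {C : ℝ} (hf : IsPotential Λ m f C)
    (hC : 0 < C) (s : State m) : ∃ i, CanMove m s i := by
  by_contra! h
  have := hf.sum_gain s
  simp only [gain_of_not_canMove (h _), mul_zero, Finset.sum_const_zero] at this
  exact hC.ne this

/-- To first order in `η`, the logarithmic moment generating function of the gain is `η C`. -/
theorem IsPotential.hasDerivAt {f : State m → ℝ} {C : ℝ} (hf : IsPotential Λ m f C) (s : State m) :
    HasDerivAt (fun η => ∑ i, Λ i * (Real.exp (η * gain m f s i) - 1)) C 0 := by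
  rw [← hf.sum_gain s]
  refine HasDerivAt.fun_sum fun i _ => ?_
  have h1 : HasDerivAt (fun η : ℝ => η * gain m f s i) (gain m f s i) 0 := by
    simpa using (hasDerivAt_id (0 : ℝ)).mul_const (gain m f s i)
  simpa using (h1.exp.sub_const 1).const_mul (Λ i)

theorem IsPotential.exists_pos_le {f : State m → ℝ} {C D : ℝ} (hf : IsPotential Λ m f C)
    (hD : C < D) :
    ∃ η > 0, ∀ s, ∑ i, Λ i * (Real.exp (η * gain m f s i) - 1) ≤ η * D := by
  have h : ∀ᶠ η : ℝ in 𝓝[>] 0, ∀ s, ∑ i, Λ i * (Real.exp (η * gain m f s i) - 1) ≤ η * D := by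
    refine eventually_all.2 fun s => ?_
    have h1 := (hf.hasDerivAt s).tendsto_slope.mono_left
      (nhdsWithin_mono 0 fun x (hx : 0 < x) => hx.ne')
    filter_upwards [h1.eventually (gt_mem_nhds hD), self_mem_nhdsWithin] with η hη hη0
    have hη0 : 0 < η := hη0
    simp only [slope_def_field, zero_mul, Real.exp_zero, sub_self, mul_zero, Finset.sum_const_zero,
      sub_zero] at hη
    rw [div_lt_iff₀ hη0] at hη
    linarith
  obtain ⟨η, h1, h2⟩ := (h.and self_mem_nhdsWithin).exists
  exact ⟨η, h2, h1⟩

theorem IsPotential.exists_neg_le {f : State m → ℝ} {C D : ℝ} (hf : IsPotential Λ m f C)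
    (hD : D < C) :
    ∃ η < 0, ∀ s, ∑ i, Λ i * (Real.exp (η * gain m f s i) - 1) ≤ η * D := by
  have h : ∀ᶠ η : ℝ in 𝓝[<] 0, ∀ s, ∑ i, Λ i * (Real.exp (η * gain m f s i) - 1) ≤ η * D := by
    refine eventually_all.2 fun s => ?_
    have h1 := (hf.hasDerivAt s).tendsto_slope.mono_left
      (nhdsWithin_mono 0 fun x (hx : x < 0) => hx.ne)
    filter_upwards [h1.eventually (lt_mem_nhds hD), self_mem_nhdsWithin] with η hη hη0
    have hη0 : η < 0 := hη0
    simp only [slope_def_field, zero_mul, Real.exp_zero, sub_self, mul_zero, Finset.sum_const_zero,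
      sub_zero] at hη
    rw [lt_div_iff_of_neg hη0] at hη
    linarith
  obtain ⟨η, h1, h2⟩ := (h.and self_mem_nhdsWithin).exists
  exact ⟨η, h2, h1⟩

/-- Service times given for the first `T` packets only, extended by `0`. -/
def extend (T : ℕ) (x : Fin (r + 2) × Fin T → ℝ) (i : Fin (r + 2)) (k : ℕ) : ℝ :=
  if h : k < T then x (i, ⟨k, h⟩) else 0

theorem measurable_departureFrom_extend (m : Fin (r + 1) → ℕ+) (a : Fin (r + 2) → ℕ) (T : ℕ) :
    ∀ k i, Measurable fun x => departureFrom m a (extend T x) k i := by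
  refine packet_induction (fun i => ?_) fun k i h1 h2 => ?_
  · simp only [departureFrom_of_le (Nat.zero_le _)]
    exact measurable_const
  · have he : Measurable fun x : Fin (r + 2) × Fin T → ℝ => extend T x i k := by
      unfold extend
      split_ifs <;> fun_prop
    by_cases ha : k + 1 ≤ a i
    · simp only [departureFrom_of_le ha]
      exact measurable_const
    · conv =>
        enter [1, x]
        rw [departureFrom, if_neg ha]
      refine ((h1 k le_rfl i).max (Measurable.max ?_ ?_)).add he
      · split_ifs with hi
        · exact h2 _ (by rw [Fin.lt_def]; simp only; omega)
        · exact measurable_const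
      · split_ifs with hi
        · exact h1 _ (by have := (m ⟨i, hi⟩).pos; omega) _
        · exact measurable_const

open ExponentialClocks

/-- A common bound for the number of services completed before the `n`-th packet is delivered. -/
def horizon (m : Fin (r + 1) → ℕ+) (n : ℕ) : ℕ := n + (r + 1) * ∑ j, (m j : ℕ)

theorem Valid.lt_horizon {a : Fin (r + 2) → ℕ} (ha : Valid m a) {n : ℕ}
    (hn : a (Fin.last (r + 1)) < n) (i : Fin (r + 2)) : a i < horizon m n := by
  have h1 := ha.le_last i
  have h2 : (r + 1 - (i : ℕ)) * ∑ j, (m j : ℕ) ≤ (r + 1) * ∑ j, (m j : ℕ) :=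
    Nat.mul_le_mul_right _ (Nat.sub_le _ _)
  unfold horizon
  omega

/-- Bound for the Laplace transform of the remaining time until the `n`-th delivery. -/
theorem lintegral_exp_departureFrom_le (hΛ : ∀ i, 0 < Λ i) {f : State m → ℝ} {θ η K : ℝ}
    (hK : ∀ s, η * f s ≤ K) (hmove : ∀ s, ∃ i, CanMove m s i)
    (hθ : ∀ s, ∑ i, Λ i * (Real.exp (η * gain m f s i) - 1) ≤ θ) (n : ℕ)
    (a : Fin (r + 2) → ℕ) (ha : Valid m a) (hn : a (Fin.last (r + 1)) ≤ n) :
    ∫⁻ x, ENNReal.ofReal (Real.exp (-(θ *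
        departureFrom m a (extend (horizon m n) x) n (Fin.last (r + 1)))))
        ∂Measure.pi (fun q : Fin (r + 2) × Fin (horizon m n) => expMeasure (Λ q.1))
      ≤ ENNReal.ofReal (Real.exp
        (K - η * (n - a (Fin.last (r + 1))) - η * f (occupancy m a))) := by
  classical
  have hprob := fun q : Fin (r + 2) × Fin (horizon m n) => isProbabilityMeasure_expMeasure (hΛ q.1)
  -- Every completion lowers the number of services left below the horizon. The horizon depends only
  -- on `n`, so the product space stays fixed.
  induction hd : ∑ i, (horizon m n - a i) using Nat.strong_induction_on generalizing a with
  | _ d ih =>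
  rcases hn.eq_or_lt with hn | hn
  · simp only [departureFrom_of_le hn.ge, mul_zero, neg_zero, Real.exp_zero, ENNReal.ofReal_one,
      lintegral_one, measure_univ]
    rw [ENNReal.one_le_ofReal, Real.one_le_exp_iff, hn]
    linarith [hK (occupancy m a)]
  have hT := ha.lt_horizon hn
  let front : Fin (r + 2) ↪ Fin (r + 2) × Fin (horizon m n) :=
    ⟨fun i => (i, ⟨a i, hT i⟩), fun i j h => (Prod.ext_iff.1 h).1⟩
  have hfront : ∀ i, front i = (i, ⟨a i, hT i⟩) := fun _ => rfl
  let B : Finset (Fin (r + 2)) := Finset.univ.filter (Ready m a)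
  have hB : ∀ i, i ∈ B ↔ Ready m a i := fun i => by simp [B]
  have hA : ∀ q : Fin (r + 2) × Fin (horizon m n),
      q ∈ B.map front ↔ Ready m a q.1 ∧ (q.2 : ℕ) = a q.1 := by
    rintro ⟨i, k⟩
    simp only [Finset.mem_map, hB, hfront, Prod.mk.injEq]
    constructor
    · rintro ⟨j, hj, rfl, rfl⟩
      exact ⟨hj, rfl⟩
    · rintro ⟨h1, h2⟩
      exact ⟨i, h1, rfl, Fin.ext h2.symm⟩
  obtain ⟨i₀, hi₀⟩ := hmove (occupancy m a)
  have hi₀B : i₀ ∈ B := (hB _).2 ((ha.ready_iff i₀).2 hi₀)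
  -- Servers that are not ready have zero gain, so they drop out of `hθ`. The bound also makes the
  -- total rate plus `θ` positive when `θ` is negative.
  have hθB : ∑ i ∈ B, Λ i * Real.exp (η * gain m f (occupancy m a) i) ≤ ∑ i ∈ B, Λ i + θ := by
    have h1 := hθ (occupancy m a)
    rw [← Finset.sum_subset (Finset.subset_univ B) fun i _ hi => ?_] at h1
    · simp only [mul_sub, mul_one, Finset.sum_sub_distrib] at h1
      linarith
    · rw [hB, ha.ready_iff] at hi
      simp [gain_of_not_canMove hi]
  have hpos : 0 < ∑ i ∈ B, Λ i + θ :=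
    (Finset.sum_pos (fun i _ => mul_pos (hΛ i) (Real.exp_pos _)) ⟨i₀, hi₀B⟩).trans_le hθB
  have hmeas : ∀ b : Fin (r + 2) → ℕ, Measurable fun x => ENNReal.ofReal (Real.exp (-(θ *
      departureFrom m b (extend (horizon m n) x) n (Fin.last (r + 1))))) := fun b =>
    (Real.measurable_exp.comp
      ((measurable_departureFrom_extend m b _ n _).const_mul θ).neg).ennreal_ofReal
  have hstep := lintegral_pi_exp_le_sum (l := fun q : Fin (r + 2) × Fin (horizon m n) => Λ q.1)
    (fun q => hΛ q.1) (A := B.map front) (Finset.Nonempty.map ⟨i₀, hi₀B⟩) (θ := θ)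
    (by rw [Finset.sum_map]; exact hpos) (hmeas a) ?_
  · rw [Finset.sum_map, Finset.sum_map] at hstep
    refine hstep.trans ?_
    set U := Real.exp (K - η * (n - a (Fin.last (r + 1))) - η * f (occupancy m a)) with hU
    have hterm : ∀ i ∈ B, ENNReal.ofReal (Λ i / (∑ i ∈ B, Λ i + θ)) *
        ∫⁻ x, ENNReal.ofReal (Real.exp (-(θ * departureFrom m a
          (extend (horizon m n) (Function.update x (front i) 0)) n (Fin.last (r + 1)))))
          ∂Measure.pi (fun q : Fin (r + 2) × Fin (horizon m n) => expMeasure (Λ q.1))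
        ≤ ENNReal.ofReal (Λ i / (∑ i ∈ B, Λ i + θ) *
          (U * Real.exp (η * gain m f (occupancy m a) i))) := by
      intro i hi
      have hr : Ready m a i := (hB i).1 hi
      rw [ENNReal.ofReal_mul (div_nonneg (hΛ i).le hpos.le)]
      gcongr
      -- The clock that has just rung becomes a completed service; its coordinate is then never read
      -- again, so the zero can be replaced by a fresh value.
      have hdep : ∀ x, departureFrom m a (extend (horizon m n) (Function.update x (front i) 0)) n
          (Fin.last (r + 1)) = departureFrom m (Function.update a i (a i + 1))
            (extend (horizon m n) x) n (Fin.last (r + 1)) := by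
        intro x
        rw [departureFrom_update hr (by simp [extend, hT i, hfront])]
        refine departureFrom_congr (n := n) (fun j k hjk _ => ?_) n _ le_rfl
        unfold extend
        refine dite_congr rfl (fun hk => ?_) fun _ => rfl
        refine Function.update_of_ne (fun h => ?_) _ _
        simp only [hfront, Prod.mk.injEq, Fin.mk.injEq] at h
        obtain ⟨rfl, rfl⟩ := h
        simp at hjk
      simp only [hdep]
      have hlast : ((Function.update a i (a i + 1) (Fin.last (r + 1)) : ℕ) : ℝ)
          = a (Fin.last (r + 1)) + if i = Fin.last (r + 1) ∧ CanMove m (occupancy m a) i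
            then 1 else 0 := by
        have hc := (ha.ready_iff i).1 hr
        rcases eq_or_ne i (Fin.last (r + 1)) with rfl | h
        · simp [hc]
        · simp [h, Function.update_of_ne h.symm]
      refine (ih _ ?_ _ (ha.update hr) ?_ rfl).trans (ENNReal.ofReal_le_ofReal (le_of_eq ?_))
      · rw [← hd]
        refine Finset.sum_lt_sum (fun j _ => ?_) ⟨i, Finset.mem_univ i, ?_⟩
        · rcases eq_or_ne j i with rfl | h
          · rw [Function.update_self]; omega
          · rw [Function.update_of_ne h]
        · rw [Function.update_self]
          have := hT i
          omega
      · rcases eq_or_ne i (Fin.last (r + 1)) with rfl | h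
        · rw [Function.update_self]; omega
        · rw [Function.update_of_ne h.symm]; omega
      · rw [hU, ← Real.exp_add, hlast, ha.occupancy_update hr, gain]
        congr 1
        ring
    refine (Finset.sum_le_sum hterm).trans ?_
    rw [← ENNReal.ofReal_sum_of_nonneg fun i _ =>
      mul_nonneg (div_nonneg (hΛ i).le hpos.le) (by positivity)]
    refine ENNReal.ofReal_le_ofReal ?_
    have : ∑ i ∈ B, Λ i / (∑ i ∈ B, Λ i + θ) * (U * Real.exp (η * gain m f (occupancy m a) i))
        = U * ((∑ i ∈ B, Λ i * Real.exp (η * gain m f (occupancy m a) i))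
          / (∑ i ∈ B, Λ i + θ)) := by
      rw [Finset.sum_div, Finset.mul_sum]
      exact Finset.sum_congr rfl fun i _ => by ring
    rw [this]
    exact mul_le_of_le_one_right (Real.exp_nonneg _) ((div_le_one hpos).2 hθB)
  · intro x hx t ht
    rw [departureFrom_add (S := extend (horizon m n) x)
        (S' := extend (horizon m n) (shift (B.map front) t x)) ht (fun i k => ?_) (fun i k => ?_)
        n _ hn, ← ENNReal.ofReal_mul (Real.exp_nonneg _), ← Real.exp_add]
    · refine ENNReal.ofReal_le_ofReal (Real.exp_le_exp.2 (le_of_eq ?_))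
      ring
    · unfold extend
      split_ifs
      · exact hx _
      · exact le_rfl
    · unfold extend shift
      by_cases hk : k < horizon m n
      · rw [dif_pos hk, dif_pos hk]
        simp only [hA]
        split_ifs <;> simp
      · rw [dif_neg hk, dif_neg hk, if_neg, add_zero]
        rintro ⟨-, rfl⟩
        exact hk (hT i)

end LineNetwork

/-! ### Almost sure asymptotics of the delivery times. -/

namespace LineNetwork

variable {r : ℕ} {m : Fin (r + 1) → ℕ+} {Λ : Fin (r + 2) → ℝ}

variable {Ω : Type*} [MeasurableSpace Ω] {P : Measure Ω} [IsProbabilityMeasure P]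
  {S : Fin (r + 2) → ℕ → Ω → ℝ}

/-- The delivery time of the `n`-th packet as a random variable. -/
noncomputable def deliveryTime (m : Fin (r + 1) → ℕ+) (S : Fin (r + 2) → ℕ → Ω → ℝ) (n : ℕ)
    (ω : Ω) : ℝ :=
  departureTime m (fun i k => S i k ω) n (Fin.last (r + 1))

theorem lintegral_exp_deliveryTime_le (hΛ : ∀ i, 0 < Λ i)
    (hS_law : ∀ i k, HasLaw (S i k) (expMeasure (Λ i)) P)
    (hS_indep : iIndepFun (fun (q : Fin (r + 2) × ℕ) => S q.1 q.2) P)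
    {f : State m → ℝ} {θ η K : ℝ}
    (hK : ∀ s, η * f s ≤ K) (hmove : ∀ s, ∃ i, CanMove m s i)
    (hθ : ∀ s, ∑ i, Λ i * (Real.exp (η * gain m f s i) - 1) ≤ θ) (n : ℕ) :
    AEMeasurable (fun ω => ENNReal.ofReal (Real.exp (-(θ * deliveryTime m S n ω)))) P ∧
    ∫⁻ ω, ENNReal.ofReal (Real.exp (-(θ * deliveryTime m S n ω))) ∂P
      ≤ ENNReal.ofReal (Real.exp (K - η * n - η * f (occupancy m 0))) := by
  let X : Ω → Fin (r + 2) × Fin (horizon m n) → ℝ := fun ω q => S q.1 q.2 ω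
  have hSm : ∀ i k, AEMeasurable (S i k) P := fun i k => (hS_law i k).aemeasurable
  have hX : AEMeasurable X P := aemeasurable_pi_lambda _ fun q => hSm _ _
  have hind : iIndepFun (fun (q : Fin (r + 2) × Fin (horizon m n)) => S q.1 q.2) P :=
    hS_indep.precomp (g := fun q : Fin (r + 2) × Fin (horizon m n) => (q.1, (q.2 : ℕ)))
      fun p q h => by
        simp only [Prod.mk.injEq] at h
        exact Prod.ext h.1 (Fin.ext h.2)
  have hlaw : P.map X =
      Measure.pi (fun q : Fin (r + 2) × Fin (horizon m n) => expMeasure (Λ q.1)) := by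
    rw [(iIndepFun_iff_map_fun_eq_pi_map fun q => hSm _ _).1 hind]
    congr 1
    funext q
    exact (hS_law _ _).map_eq
  have hD : ∀ ω, deliveryTime m S n ω
      = departureFrom m 0 (extend (horizon m n) (X ω)) n (Fin.last (r + 1)) := by
    intro ω
    rw [deliveryTime, ← departureFrom_zero_eq]
    refine departureFrom_congr (n := n) (fun i k _ hk => ?_) n _ le_rfl
    have : k < horizon m n := lt_of_lt_of_le hk (Nat.le_add_right _ _)
    simp [extend, this, X]
  have hmeas : Measurable fun x => ENNReal.ofReal (Real.exp (-(θ *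
      departureFrom m 0 (extend (horizon m n) x) n (Fin.last (r + 1))))) :=
    (Real.measurable_exp.comp
      ((measurable_departureFrom_extend m 0 _ n _).const_mul θ).neg).ennreal_ofReal
  simp only [hD]
  refine ⟨hmeas.comp_aemeasurable hX, ?_⟩
  rw [← lintegral_map' hmeas.aemeasurable hX, hlaw]
  refine (lintegral_exp_departureFrom_le hΛ hK hmove hθ n 0 (fun j => by simp) (by simp)).trans ?_
  simp

/-- Large deviations of delivery times are eventually absent. -/
theorem ae_eventually_lt_deliveryTime (hΛ : ∀ i, 0 < Λ i)
    (hS_law : ∀ i k, HasLaw (S i k) (expMeasure (Λ i)) P)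
    (hS_indep : iIndepFun (fun (q : Fin (r + 2) × ℕ) => S q.1 q.2) P)
    {f : State m → ℝ} {θ η c : ℝ} (hmove : ∀ s, ∃ i, CanMove m s i)
    (hθ : ∀ s, ∑ i, Λ i * (Real.exp (η * gain m f s i) - 1) ≤ θ) (hc : θ * c < η) :
    ∀ᵐ ω ∂P, ∀ᶠ n : ℕ in atTop, θ * (c * n) < θ * deliveryTime m S n ω := by
  obtain ⟨s₀, hs₀⟩ := Finite.exists_max fun s => η * f s
  set K := η * f s₀
  set L := Real.exp (K - η * f (occupancy m 0))
  -- Chernoff bound, geometric in `n` because `θ * c < η`. Keeping `θ` on both sides covers both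
  -- tails: its sign selects which.
  have hb : ∀ n : ℕ, P {ω | θ * deliveryTime m S n ω ≤ θ * (c * n)}
      ≤ ENNReal.ofReal (L * Real.exp (θ * c - η) ^ n) := by
    intro n
    obtain ⟨hm, hle⟩ := lintegral_exp_deliveryTime_le hΛ hS_law hS_indep hs₀ hmove hθ n
    have h1 := (mul_meas_ge_le_lintegral₀ hm
      (ENNReal.ofReal (Real.exp (-(θ * (c * n)))))).trans hle
    have h2 : {ω | θ * deliveryTime m S n ω ≤ θ * (c * n)}
        = {ω | ENNReal.ofReal (Real.exp (-(θ * (c * n))))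
          ≤ ENNReal.ofReal (Real.exp (-(θ * deliveryTime m S n ω)))} := by
      ext ω
      simp only [Set.mem_ofPred_eq]
      rw [ENNReal.ofReal_le_ofReal_iff (Real.exp_nonneg _), Real.exp_le_exp, neg_le_neg_iff]
    rw [h2]
    have h3 : ENNReal.ofReal (Real.exp (-(θ * (c * n)))) ≠ 0 := by
      rw [Ne, ENNReal.ofReal_eq_zero, not_le]
      exact Real.exp_pos _
    rw [mul_comm, ← ENNReal.le_div_iff_mul_le (Or.inl h3) (Or.inl ENNReal.ofReal_ne_top),
      ← ENNReal.ofReal_div_of_pos (Real.exp_pos _)] at h1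
    refine h1.trans (ENNReal.ofReal_le_ofReal (le_of_eq ?_))
    rw [← Real.exp_sub, ← Real.exp_nat_mul, ← Real.exp_add]
    congr 1
    ring
  have hsum : Summable fun n : ℕ => L * Real.exp (θ * c - η) ^ n :=
    (summable_geometric_of_lt_one (Real.exp_nonneg _)
      (Real.exp_lt_one_iff.2 (by linarith))).mul_left _
  have hne : ∑' n : ℕ, P {ω | θ * deliveryTime m S n ω ≤ θ * (c * n)} ≠ ⊤ := by
    refine ne_top_of_le_ne_top ?_ (ENNReal.tsum_le_tsum hb)
    exact hsum.tsum_ofReal_ne_top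
  filter_upwards [ae_eventually_notMem hne] with ω hω
  filter_upwards [hω] with n hn
  simpa using hn

theorem ae_tendsto_deliveryTime_div (hΛ : ∀ i, 0 < Λ i)
    (hS_law : ∀ i k, HasLaw (S i k) (expMeasure (Λ i)) P)
    (hS_indep : iIndepFun (fun (q : Fin (r + 2) × ℕ) => S q.1 q.2) P)
    {f : State m → ℝ} {C : ℝ} (hf : IsPotential Λ m f C) (hC : 0 < C) :
    ∀ᵐ ω ∂P, Tendsto (fun n : ℕ => deliveryTime m S n ω / n) atTop (𝓝 C⁻¹) := by
  have hmove := hf.exists_canMove hC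
  have hlow : ∀ᵐ ω ∂P, ∀ q : ℚ, (q : ℝ) < C⁻¹ →
      ∀ᶠ n : ℕ in atTop, (q : ℝ) < deliveryTime m S n ω / n := by
    refine ae_all_iff.2 fun q => ?_
    by_cases hq : (q : ℝ) < C⁻¹
    -- The maximum with zero keeps `c` positive even for negative `q`; then `D` can be taken between
    -- `C` and `c⁻¹`, so that `D * c < 1` and `θ = η * D` is admissible.
    · obtain ⟨c, hc1, hc2⟩ := exists_between (max_lt hq (inv_pos.2 hC))
      have hc0 : 0 < c := (le_max_right _ _).trans_lt hc1
      obtain ⟨D, hD1, hD2⟩ := exists_between ((lt_inv_comm₀ hc0 hC).1 hc2)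
      obtain ⟨η, hη, hle⟩ := hf.exists_pos_le hD1
      have hDc : D * c < 1 := by
        rwa [lt_inv_comm₀ (hC.trans hD1) hc0, ← one_div, lt_div_iff₀ (hC.trans hD1), mul_comm]
          at hD2
      filter_upwards [ae_eventually_lt_deliveryTime hΛ hS_law hS_indep hmove hle (c := c)
        (by rw [mul_assoc]; exact mul_lt_of_lt_one_right hη hDc)] with ω hω _
      filter_upwards [hω, eventually_gt_atTop 0] with n hn hn0
      rw [mul_lt_mul_iff_right₀ (mul_pos hη (hC.trans hD1))] at hn
      rw [lt_div_iff₀ (by exact_mod_cast hn0)]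
      refine lt_of_le_of_lt ?_ hn
      gcongr
      exact ((le_max_left _ _).trans_lt hc1).le
    · exact Eventually.of_forall fun _ h => absurd h hq
  have hupp : ∀ᵐ ω ∂P, ∀ q : ℚ, C⁻¹ < (q : ℝ) →
      ∀ᶠ n : ℕ in atTop, deliveryTime m S n ω / n < (q : ℝ) := by
    refine ae_all_iff.2 fun q => ?_
    by_cases hq : C⁻¹ < (q : ℝ)
    · have hq0 : (0 : ℝ) < q := (inv_pos.2 hC).trans hq
      obtain ⟨D, hD1, hD2⟩ := exists_between ((inv_lt_comm₀ hC hq0).1 hq)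
      have hD0 : 0 < D := (inv_pos.2 hq0).trans hD1
      obtain ⟨η, hη, hle⟩ := hf.exists_neg_le hD2
      have hDq : 1 < D * q := by
        rwa [inv_lt_iff_one_lt_mul₀ hq0] at hD1
      -- Now `η` and `θ = η * D` are negative, so `D * q > 1` is what gives `θ * q < η`, and
      -- cancelling `θ` reverses the inequality.
      filter_upwards [ae_eventually_lt_deliveryTime hΛ hS_law hS_indep hmove hle (c := q)
        (by rw [mul_assoc]; nlinarith)] with ω hω _
      filter_upwards [hω, eventually_gt_atTop 0] with n hn hn0
      rw [mul_lt_mul_left_of_neg (mul_neg_of_neg_of_pos hη hD0)] at hn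
      rwa [div_lt_iff₀ (by exact_mod_cast hn0)]
    · exact Eventually.of_forall fun _ h => absurd h hq
  filter_upwards [hlow, hupp] with ω h1 h2
  refine tendsto_order.2 ⟨fun b hb => ?_, fun b hb => ?_⟩
  · obtain ⟨q, hq1, hq2⟩ := exists_rat_btwn hb
    filter_upwards [h1 q hq2] with n hn using hq1.trans hn
  · obtain ⟨q, hq1, hq2⟩ := exists_rat_btwn hb
    filter_upwards [h2 q hq1] with n hn using hn.trans hq2

theorem departureTime_le_succ {σ : Fin (r + 2) → ℕ → ℝ} (hσ : ∀ i k, 0 ≤ σ i k) (k : ℕ)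
    (i : Fin (r + 2)) : departureTime m σ k i ≤ departureTime m σ (k + 1) i := by
  conv_rhs => rw [departureTime]
  exact (le_max_left _ _).trans (le_add_of_nonneg_right (hσ i k))

end LineNetwork

/-! ### From delivery times to the counting rate, and the main theorem. -/

/-- If the `n`-th event of a counting process happens at time `d n ~ n / C`, then events occur at
rate `C`. -/
theorem finite_and_tendsto_ncard_div {d : ℕ → ℝ} (hd : Monotone d) {C : ℝ} (hC : 0 < C)
    (h : Tendsto (fun n : ℕ => d n / n) atTop (𝓝 C⁻¹)) :
    (∀ t, {k | d (k + 1) < t}.Finite) ∧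
      Tendsto (fun t : ℝ => ({k | d (k + 1) < t}.ncard : ℝ) / t) atTop (𝓝 C) := by
  have hdtop : Tendsto d atTop atTop := by
    have h1 := h.pos_mul_atTop (inv_pos.2 hC) tendsto_natCast_atTop_atTop
    refine h1.congr' ?_
    filter_upwards [eventually_gt_atTop 0] with n hn
    rw [div_mul_cancel₀]
    exact_mod_cast hn.ne'
  have hcount : ∀ t, ∃ N : ℕ, {k | d (k + 1) < t} = Set.Iio N := by
    intro t
    have hex : ∃ N, t ≤ d (N + 1) :=
      ((hdtop.comp (tendsto_add_atTop_nat 1)).eventually_ge_atTop t).exists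
    classical
    refine ⟨Nat.find hex, Set.ext fun k => ⟨fun hk => ?_, fun hk => ?_⟩⟩
    · by_contra hlt
      have h1 := Nat.find_spec hex
      have h2 : d (Nat.find hex + 1) ≤ d (k + 1) := hd (by
        simp only [Set.mem_Iio, not_lt] at hlt; omega)
      exact absurd (hk : d (k + 1) < t) (not_lt.2 (h1.trans h2))
    · exact not_le.1 (Nat.find_min hex hk)
  choose N hN using hcount
  have hcard : ∀ t, {k | d (k + 1) < t}.ncard = N t := fun t => by
    rw [hN, ← Finset.coe_range, Set.ncard_coe_finset, Finset.card_range]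
  refine ⟨fun t => by rw [hN]; exact Set.finite_Iio _, ?_⟩
  simp only [hcard]
  have hmem : ∀ t k, d (k + 1) < t ↔ k < N t := fun t k => by
    have : k ∈ {k | d (k + 1) < t} ↔ k ∈ Set.Iio (N t) := by rw [hN]
    exact this
  have hNtop : Tendsto N atTop atTop := by
    refine tendsto_atTop.2 fun k => ?_
    filter_upwards [eventually_gt_atTop (d (k + 1))] with t ht
    exact ((hmem t k).1 ht).le
  have hlow := h.comp hNtop
  have hupp : Tendsto (fun t => d (N t + 1) / (N t : ℝ)) atTop (𝓝 C⁻¹) := by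
    have h1 : Tendsto (fun n : ℕ => d (n + 1) / (n : ℝ)) atTop (𝓝 C⁻¹) := by
      have h2 := (h.comp (tendsto_add_atTop_nat 1)).mul
        (tendsto_const_nhds (x := (1 : ℝ)) |>.add tendsto_one_div_atTop_nhds_zero_nat)
      rw [add_zero, mul_one] at h2
      refine h2.congr' ?_
      filter_upwards [eventually_gt_atTop 0] with n hn
      have hn' : (n : ℝ) ≠ 0 := by exact_mod_cast hn.ne'
      simp only [Function.comp_apply, Nat.cast_add, Nat.cast_one]
      field_simp
    exact h1.comp hNtop
  -- Squeeze `d (N t) < t ≤ d (N t + 1)`; the left bound needs `N t > 0`.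
  have hmain : Tendsto (fun t => t / (N t : ℝ)) atTop (𝓝 C⁻¹) := by
    refine tendsto_of_tendsto_of_tendsto_of_le_of_le' hlow hupp ?_ ?_
    · filter_upwards [hNtop.eventually_gt_atTop 0] with t ht
      simp only [Function.comp_apply]
      gcongr
      have := (hmem t (N t - 1)).2 (by omega)
      rw [Nat.sub_add_cancel ht] at this
      exact this.le
    · refine Eventually.of_forall fun t => ?_
      gcongr
      exact not_lt.1 fun hlt => lt_irrefl _ ((hmem t (N t)).1 hlt)
  have := hmain.inv₀ (inv_pos.2 hC).ne'
  simpa [inv_div] using this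

theorem mainTheorem6 {r : ℕ} (m : Fin (r + 1) → ℕ+) (Λ : Fin (r + 2) → ℝ) (hΛ : ∀ i, 0 < Λ i)
    {Ω : Type*} [MeasurableSpace Ω] (P : Measure Ω) [IsProbabilityMeasure P]
    (S : Fin (r + 2) → ℕ → Ω → ℝ)
    (hS_law : ∀ i k, HasLaw (S i k) (expMeasure (Λ i)) P)
    (hS_indep : iIndepFun (fun (q : Fin (r + 2) × ℕ) => S q.1 q.2) P) :
    ∃ C : ℝ,
      (∀ᵐ ω ∂P,
        (∀ t : ℝ, (LineNetwork.collected m (fun i k => S i k ω) t).Finite) ∧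
        Tendsto (fun t : ℝ => ((LineNetwork.collected m (fun i k => S i k ω) t).ncard : ℝ) / t)
          atTop (𝓝 C)) ∧
      (∀ τ : ℝ, 0 < τ → (∀ i, Λ i * τ < 1) →
        ∃! p, LineNetwork.IsSteadyState (fun i => 1 - Λ i * τ) m p) ∧
      Tendsto (fun τ : ℝ => τ⁻¹ * LineNetwork.perfectFeedbackCapacity (fun i => 1 - Λ i * τ) m)
        (𝓝[>] 0) (𝓝 C) := by
  obtain ⟨f, C, hf, hC⟩ := LineNetwork.exists_isPotential hΛ m
  refine ⟨C, ?_, fun τ hτ0 hτ => ?_, LineNetwork.tendsto_perfectFeedbackCapacity hΛ hf⟩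
  -- Nonnegative service times, hence monotone delivery times, hold only almost surely.
  · have hS : ∀ᵐ ω ∂P, ∀ i k, 0 ≤ S i k ω := by
      refine ae_all_iff.2 fun i => ae_all_iff.2 fun k => ?_
      have h := ExponentialClocks.ae_nonneg_expMeasure (Λ i)
      rw [← (hS_law i k).map_eq] at h
      exact ae_of_ae_map (hS_law i k).aemeasurable h
    filter_upwards [hS, LineNetwork.ae_tendsto_deliveryTime_div hΛ hS_law hS_indep hf hC]
      with ω h1 h2
    exact finite_and_tendsto_ncard_div
      (monotone_nat_of_le_succ fun k => LineNetwork.departureTime_le_succ h1 k _) hC h2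
  · exact LineNetwork.existsUnique_isSteadyState (fun i => by linarith [hτ i])
      (fun i => by have := mul_pos (hΛ i) hτ0; linarith) m
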